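/- **Setting.** Let $M$ be an episodic MDP with a measurable state space $\mathcal S$, a finite action space $\mathcal A$, horizon $H\ge 1$, transition kernels $\mathbb P_h(\cdot\mid s,a)$ and random rewards $r_h(s,a)\in[0,1]$ with means $R_h(s,a)$, $h\in[H]$; write $x=(s,a)$. For a policy $\pi=\{\pi_h(\cdot\mid s)\}_{h\in[H]}$ let $V^\pi_1(s)=\mathbb E_\pi[\sum_{h=1}^H r_h(s_h,a_h)\mid s_1=s]$ and $\mathrm{SubOpt}(\pi,s)=\sup_{\pi'}V_1^{\pi'}(s)-V_1^\pi(s)$. Let $d\ge 1$. $M$ is a *linear MDP* with known measurable feature map $\phi:\mathcal S\times\mathcal A\to\mathbb R^d$, $\|\phi\|_2\le 1$, if there are a reference measure $ds$ on $\mathcal S$, unknown functions $w_h^*:\mathcal S\to\mathbb R^d$ and unknown vectors $\theta^*_h\in\mathbb R^d$ with $\int_{\mathcal S}\|w^*_h(s)\|_2\,ds\le\sqrt d$, $\|\theta_h^*\|_2\le\sqrt d$, such that for all $h\in[H]$ $$\mathbb P_h(ds'\mid x)=\langle\phi(x),w_h^*(s')\rangle\,ds',\qquad R_h(x)=\langle\phi(x),\theta_h^*\rangle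 .$$ More generally, a measurable set $\mathcal Z\subseteq\mathcal S$ of null (terminal) states is allowed, with $\phi(s,a)=0$ for $s\in\mathcal Z$; the formula for $\mathbb P_h$ is then required only on subsets of $\mathcal S\setminus\mathcal Z$, so that null states are absorbing and give no reward. The case $\mathcal Z=\emptyset$ is the usual linear MDP. **Data.** $\mathcal D$ consists of $N\ge1$ i.i.d. pairs $(\tau,r(\tau))$, where $\tau=(x_1^\tau,\dots,x_H^\tau)$ is generated by a fixed behaviour policy $\mu$ (from some initial distribution) and only the trajectory reward $r(\tau)=\sum_{h}r_h(x^\tau_h)$ is observed. Put $\Phi(\tau)=[\phi(x_1^\tau)^\top,\dots,\phi(x_H^\tau)^\top]^\top\in\mathbb R^{dH}$, and let $\Phi_h(x)\in\mathbb R^{dH}$ be the vector whose $h$-th block is $\phi(x)$ and whose other blocks are $0$. The data set is *well explored* with constants $C_\sigma,C_\varsigma>0$: $\lambda_{\min}(\mathbb E_\mu[\Phi(\tau)\Phi(\tau)^\top])\ge C_\sigma$ and $\lambda_{\min}(\mathbb E_\mu[\phi(x_h^\tau)\phi(x_h^\tau)^\top])\ge C_\varsigma$ for all $h\in[H]$.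 **Algorithm (PARTED for linear MDPs).** With parameters $\lambda_1,\lambda_2,\beta_1,\beta_2>0$: let $\widehat\Theta=(\widehat\theta_1,\dots,\widehat\theta_H)$ minimize $\sum_{\tau\in\mathcal D}\big[\sum_h\langle\phi(x_h^\tau),\theta_h\rangle-r(\tau)\big]^2+\lambda_1\sum_h\|\theta_h\|_2^2$; set $\widehat V_{H+1}=0$ and for $h=H,\dots,1$ let $\widehat w_h$ minimize $\sum_{\tau\in\mathcal D}\big(\widehat V_{h+1}(s^\tau_{h+1})-\langle\phi(x_h^\tau),w\rangle\big)^2+\lambda_2\|w\|_2^2$, and $$\widehat Q_h(x)=\min\{\langle\phi(x),\widehat\theta_h\rangle+\langle\phi(x),\widehat w_h\rangle-\beta_1 b_{r,h}(x)-\beta_2 b_{v,h}(x),\,H-h+1\}^+,$$ where $b_{r,h}(x)=[\Phi_h(x)^\top\Sigma^{-1}\Phi_h(x)]^{1/2}$, $\Sigma=\lambda_1I_{dH}+\sum_{\tau\in\mathcal D}\Phi(\tau)\Phi(\tau)^\top$, $b_{v,h}(x)=[\phi(x)^\top\Lambda_h^{-1}\phi(x)]^{1/2}$, $\Lambda_h=\lambda_2I_d+\sum_{\tau\in\mathcal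 D}\phi(x_h^\tau)\phi(x_h^\tau)^\top$; let $\widehat\pi_h(\cdot\mid s)$ be any maximizer of $\langle\widehat Q_h(s,\cdot),\pi_h(\cdot\mid s)\rangle$ and $\widehat V_h(s)=\langle\widehat Q_h(s,\cdot),\widehat\pi_h(\cdot\mid s)\rangle$. **Theorem.** For all constants $C_{\beta_1},C_{\beta_2},C_\sigma,C_\varsigma>0$ there is a constant $C>0$, depending only on these four numbers, such that the following holds for all $d,H,N\ge1$, all $\delta\in(0,1)$, every linear MDP and every data set that is well explored with constants $C_\sigma,C_\varsigma$. Let $\lambda_1=\lambda_2=1$ and $$0<\beta_1\le C_{\beta_1}H\sqrt{dH\log(N/\delta)},\qquad 0<\beta_2\le C_{\beta_2}\,dH^2\sqrt{\log(dH^3N^{5/2}/\delta)} .$$ Then, with probability at least $1-\delta$ over $\mathcal D$, for every output $\widehat\pi$ of the algorithm and all $s\in\mathcal S$, $$\mathrm{SubOpt}(\widehat\pi,s)\le C\,\frac{dH^3}{\sqrt N}\sqrt{\log\!\Big(\frac{dH^3N^{5/2}}{\delta}\Big)} .$$ -/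

import Mathlib

open MeasureTheory ProbabilityTheory

namespace PARTED

/-- An episodic Markov decision process with state space `S` and action space `A`. Steps are
numbered from `0`; in an episode of length `H` only the steps `h < H` are used.
`P h (s, a)` is the law of the next state, `rew h (s, a)` the law of the random instantaneous
reward, which takes its values in `[0, 1]`. -/
structure MDP (S A : Type*) [MeasurableSpace S] [MeasurableSpace A] where
  P : ℕ → Kernel (S × A) S
  rew : ℕ → Kernel (S × A) ℝ
  markov_P : ∀ h, IsMarkovKernel (P h)
  markov_rew : ∀ h, IsMarkovKernel (rew h)
  rew_mem : ∀ h x, ∀ᵐ r ∂(rew h x), r ∈ Set.Icc (0 : ℝ) 1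

/-- A (randomized, time-dependent) policy: `π.act h s` is the law of the action taken at step `h`
in state `s`. -/
structure Policy (S A : Type*) [MeasurableSpace S] [MeasurableSpace A] where
  act : ℕ → Kernel S A
  markov_act : ∀ h, IsMarkovKernel (act h)

section Basic

variable {S A : Type*} [MeasurableSpace S] [MeasurableSpace A]

/-- The mean reward `R_h(x)`. -/
noncomputable def MDP.meanReward (M : MDP S A) (h : ℕ) (x : S × A) : ℝ :=
  ∫ r, r ∂(M.rew h x)

/-- Law of the next `n` (state-action pair, instantaneous reward) entries of an episode that is in
a given state at step `h` and is continued with the policy `π`: draw `a ∼ π_h(s)`; given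
`x = (s, a)`, draw the reward from `rew h x` and, independently, the next state from `P h x`, from
which the remaining `n - 1` entries are generated in the same way. -/
noncomputable def rollout (M : MDP S A) (π : Policy S A) :
    (n : ℕ) → (h : ℕ) → Kernel S (Fin n → (S × A) × ℝ)
  | 0, _ => Kernel.const S (Measure.dirac Fin.elim0)
  | n + 1, h =>
      (((Kernel.id (α := S × A)) ×ₖ ((M.rew h) ×ₖ ((rollout M π n (h + 1)) ∘ₖ (M.P h)))) ∘ₖ
        ((Kernel.id (α := S)) ×ₖ (π.act h))).map
      (fun p => (Fin.cons (p.1, p.2.1) p.2.2 : Fin (n + 1) → (S × A) × ℝ))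

/-- The value `V^π_h(s)`: expected sum of the rewards of the steps `h, …, H - 1`, from `s_h = s`. -/
noncomputable def value (M : MDP S A) (H : ℕ) (π : Policy S A) (h : ℕ) (s : S) : ℝ :=
  ∫ ω, ∑ i, (ω i).2 ∂(rollout M π (H - h) h s)

/-- The optimal value at the first step. -/
noncomputable def optValue (M : MDP S A) (H : ℕ) (s : S) : ℝ :=
  ⨆ π : Policy S A, value M H π 0 s

/-- `SubOpt(π, s)`. -/
noncomputable def subOpt (M : MDP S A) (H : ℕ) (π : Policy S A) (s : S) : ℝ :=
  optValue M H s - value M H π 0 s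

/-- What the learner sees of one episode: the state-action pairs `τ` and the sum `r(τ)` of the
instantaneous rewards. -/
abbrev Episode (S A : Type*) (H : ℕ) : Type _ := (Fin H → S × A) × ℝ

/-- Law of `(τ, r(τ))` for an episode with initial state drawn from `ν₀` and policy `π`. -/
noncomputable def episodeLaw (M : MDP S A) (H : ℕ) (π : Policy S A) (ν₀ : Measure S) :
    Measure (Episode S A H) :=
  ((rollout M π H 0) ∘ₘ ν₀).map (fun ω => (fun i => (ω i).1, ∑ i, (ω i).2))

/-- `M` is a linear MDP of horizon `H` with the known feature map `φ`: there are a reference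
measure `ν` on the states (written `ds` on paper), vector-valued densities `w_h` and vectors `θ_h`
such that `P_h(ds' | x) = ⟨φ(x), w_h(s')⟩ ds'` and `R_h(x) = ⟨φ(x), θ_h⟩`, with `‖φ‖ ≤ 1`,
`∫ ‖w_h(s)‖ ds ≤ √d` and `‖θ_h‖ ≤ √d`.

`Z` is the set of null (terminal) states. Pairs at a null state have the feature `0`, and
the formula for the transitions describes the mass on the non-null states; hence null states
are absorbing and bring no reward. For `Z = ∅` this is exactly the usual notion of a linear MDP.
(For `Z = ∅` one has `⟨φ(x), ∫ w_h⟩ = 1` for all `x` and `h`, so that the second moment of the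
trajectory feature is singular as soon as there are two steps; null states are what makes a
well-explored data set possible for longer episodes.) -/
def IsLinearMDP {d : ℕ} (M : MDP S A) (H : ℕ) (Z : Set S)
    (φ : S × A → EuclideanSpace ℝ (Fin d)) : Prop :=
  MeasurableSet Z ∧ Measurable φ ∧ (∀ x, ‖φ x‖ ≤ 1) ∧ (∀ s ∈ Z, ∀ a, φ (s, a) = 0) ∧
  ∃ (ν : Measure S) (w : Fin H → S → EuclideanSpace ℝ (Fin d))
    (θ : Fin H → EuclideanSpace ℝ (Fin d)),
    ∀ h : Fin H,
      Integrable (w h) ν ∧ ∫ s, ‖w h s‖ ∂ν ≤ √(d : ℝ) ∧ ‖θ h‖ ≤ √(d : ℝ) ∧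
      (∀ x, ∀ B : Set S, MeasurableSet B → Disjoint B Z →
        (M.P h x).real B = ∫ s in B, inner ℝ (φ x) (w h s) ∂ν) ∧
      (∀ x, M.meanReward h x = inner ℝ (φ x) (θ h))

variable {d H N : ℕ}

/-- The trajectory feature `Φ(τ) ∈ ℝ^{dH}`; its coordinates are indexed by (step, coordinate). -/
def trajFeature (φ : S × A → EuclideanSpace ℝ (Fin d)) (τ : Fin H → S × A) :
    Fin H × Fin d → ℝ :=
  fun p => φ (τ p.1) p.2

/-- The one-block-hot vector `Φ_h(x) ∈ ℝ^{dH}`. -/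
def oneBlockHot (φ : S × A → EuclideanSpace ℝ (Fin d)) (h : Fin H) (x : S × A) :
    Fin H × Fin d → ℝ :=
  fun p => if p.1 = h then φ x p.2 else 0

/-- `Σ = λ₁ I + ∑_τ Φ(τ) Φ(τ)ᵀ`. -/
noncomputable def trajCov (φ : S × A → EuclideanSpace ℝ (Fin d)) (l₁ : ℝ)
    (D : Fin N → Episode S A H) : Matrix (Fin H × Fin d) (Fin H × Fin d) ℝ :=
  l₁ • 1 + ∑ i, Matrix.vecMulVec (trajFeature φ (D i).1) (trajFeature φ (D i).1)

/-- `Λ_h = λ₂ I + ∑_τ φ(x_h^τ) φ(x_h^τ)ᵀ`. -/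
noncomputable def stepCov (φ : S × A → EuclideanSpace ℝ (Fin d)) (l₂ : ℝ)
    (D : Fin N → Episode S A H) (h : Fin H) : Matrix (Fin d) (Fin d) ℝ :=
  l₂ • 1 + ∑ i, Matrix.vecMulVec (φ ((D i).1 h)).ofLp (φ ((D i).1 h)).ofLp

/-- The reward penalty `b_{r,h}`. -/
noncomputable def rewardPenalty (φ : S × A → EuclideanSpace ℝ (Fin d)) (l₁ : ℝ)
    (D : Fin N → Episode S A H) (h : Fin H) (x : S × A) : ℝ :=
  √(dotProduct (oneBlockHot φ h x) (Matrix.mulVec (trajCov φ l₁ D)⁻¹ (oneBlockHot φ h x)))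

/-- The transition penalty `b_{v,h}`. -/
noncomputable def valuePenalty (φ : S × A → EuclideanSpace ℝ (Fin d)) (l₂ : ℝ)
    (D : Fin N → Episode S A H) (h : Fin H) (x : S × A) : ℝ :=
  √(dotProduct (φ x).ofLp (Matrix.mulVec (stepCov φ l₂ D h)⁻¹ (φ x).ofLp))

/-- The regularized least-squares loss `L_r(Θ)` of the reward redistribution. -/
noncomputable def rewardLoss (φ : S × A → EuclideanSpace ℝ (Fin d)) (l₁ : ℝ)
    (D : Fin N → Episode S A H) (Θ : Fin H → EuclideanSpace ℝ (Fin d)) : ℝ :=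
  ∑ i, ((∑ h, inner ℝ (φ ((D i).1 h)) (Θ h)) - (D i).2) ^ 2 + l₁ * ∑ h, ‖Θ h‖ ^ 2

/-- `V(s_{h+1})` along `τ`. After the last step the value function is `0` and the next state is not
part of the trajectory. -/
noncomputable def nextValue (V : S → ℝ) (τ : Fin H → S × A) (h : Fin H) : ℝ :=
  if hlt : h.val + 1 < H then V (τ ⟨h.val + 1, hlt⟩).1 else 0

/-- The regularized least-squares loss `L_v^h(w)` of the transition value estimation, for the
value function `V` of the next step. -/
noncomputable def valueLoss (φ : S × A → EuclideanSpace ℝ (Fin d)) (l₂ : ℝ)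
    (D : Fin N → Episode S A H) (h : Fin H) (V : S → ℝ) (w : EuclideanSpace ℝ (Fin d)) : ℝ :=
  ∑ i, (nextValue V (D i).1 h - inner ℝ (φ ((D i).1 h)) w) ^ 2 + l₂ * ‖w‖ ^ 2

/-- `⟨q, π_h(· | s)⟩` for a function `q` of the actions. -/
noncomputable def policyAvg [Fintype A] (π : Policy S A) (h : ℕ) (s : S) (q : A → ℝ) : ℝ :=
  ∑ a, (π.act h s).real {a} * q a

/-- `πhat` is an output of PARTED for linear MDPs on the data `D`, with parameters
`λ₁, λ₂, β₁, β₂`: `Θ` minimizes the reward loss, and backwards from `V_H = 0`, `w_h` minimizes the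
value loss, `Q_h = min{⟨φ, θ_h⟩ + ⟨φ, w_h⟩ - Γ_h, H - h}⁺` (with `H - h` the number of steps that
are left), `πhat_h` is greedy for `Q_h`, and `V_h = ⟨Q_h, πhat_h⟩`. -/
def IsOutput [Fintype A] (φ : S × A → EuclideanSpace ℝ (Fin d)) (l₁ l₂ β₁ β₂ : ℝ)
    (D : Fin N → Episode S A H) (πhat : Policy S A) : Prop :=
  ∃ (Θ w : Fin H → EuclideanSpace ℝ (Fin d)) (Q : Fin H → S × A → ℝ)
    (V : Fin (H + 1) → S → ℝ),
    (∀ Θ', rewardLoss φ l₁ D Θ ≤ rewardLoss φ l₁ D Θ') ∧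
    (∀ s, V (Fin.last H) s = 0) ∧
    ∀ h : Fin H,
      (∀ w', valueLoss φ l₂ D h (V h.succ) (w h) ≤ valueLoss φ l₂ D h (V h.succ) w') ∧
      (∀ x, Q h x =
        max (min (inner ℝ (φ x) (Θ h) + inner ℝ (φ x) (w h)
          - (β₁ * rewardPenalty φ l₁ D h x + β₂ * valuePenalty φ l₂ D h x))
          ((H : ℝ) - (h : ℕ))) 0) ∧
      (∀ s, ∀ p ∈ stdSimplex ℝ A,
        ∑ a, p a * Q h (s, a) ≤ policyAvg πhat h s (fun a => Q h (s, a))) ∧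
      (∀ s, V h.castSucc s = policyAvg πhat h s (fun a => Q h (s, a)))

/-- `M̄ = E[Φ(τ) Φ(τ)ᵀ]`, for `τ` with the law `ρ`. -/
noncomputable def trajMoment (φ : S × A → EuclideanSpace ℝ (Fin d))
    (ρ : Measure (Episode S A H)) : Matrix (Fin H × Fin d) (Fin H × Fin d) ℝ :=
  Matrix.of fun p q => ∫ e, trajFeature φ e.1 p * trajFeature φ e.1 q ∂ρ

/-- `m̄_h = E[φ(x_h) φ(x_h)ᵀ]`, for `τ` with the law `ρ`. -/
noncomputable def stepMoment (φ : S × A → EuclideanSpace ℝ (Fin d))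
    (ρ : Measure (Episode S A H)) (h : Fin H) : Matrix (Fin d) (Fin d) ℝ :=
  Matrix.of fun j k => ∫ e, φ (e.1 h) j * φ (e.1 h) k ∂ρ

/-- `λ_min(M) ≥ c`, for a symmetric matrix `M`. -/
def MinEigenvalueGE {ι : Type*} [Fintype ι] [DecidableEq ι] (M : Matrix ι ι ℝ) (c : ℝ) : Prop :=
  (M - c • (1 : Matrix ι ι ℝ)).PosSemidef

/-- The well-explored data set: `λ_min(M̄) ≥ Cσ` and `λ_min(m̄_h) ≥ Cς` for every step. -/
def WellExplored (φ : S × A → EuclideanSpace ℝ (Fin d)) (ρ : Measure (Episode S A H))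
    (Cσ Cς : ℝ) : Prop :=
  MinEigenvalueGE (trajMoment φ ρ) Cσ ∧ ∀ h, MinEigenvalueGE (stepMoment φ ρ h) Cς

end Basic

end PARTED

/-!
Write `L` for the logarithm in the bound and `X = d H² √L / √N`, so that the claim reads
`SubOpt ≤ C H X`. As `SubOpt ≤ H`, only the case of a small `X` matters.

*Planning.* If every `Q_h` is within `e` of the Bellman backup `R_h + P_h V_{h+1}`, then the greedy
policy is `2 H e`-optimal (`subOpt_le_of_abs_backup_le`). Hence `e ≲ X` is to be shown. As truncation
is a contraction, `e` is at most the error of the reward redistribution plus the error of the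
transition value estimation plus the penalties. The penalties need not dominate the two errors: good
exploration makes all three of them small at every pair.

*Exploration.* By Hoeffding's inequality the entries of `∑ Φ(τ) Φ(τ)ᵀ` are close to their means, so
that `Σ` and all the `Λ_h`, whose data parts are diagonal blocks of that of `Σ`, are at least
`N Cσ / 2` (`le_sum_sq_dotProduct`). This bounds the penalties by
`(β₁ + β₂) (N Cσ / 2)^{-1/2} ≲ X`, and reduces the errors of the two ridge regressions to the size
of the noise vectors (`ridge_error_le`).

*Reward redistribution.* Given the trajectory, the noise of `r(τ)` has mean `0`
(`integral_return_noise`), and Hoeffding's inequality applies to each coordinate of `∑ Φ(τ) ε`.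

*Transition values.* For a bounded `V` that vanishes on the null states, `P_h V` is linear in the
feature (`IsLinearMDP.exists_params`). The target `V_{h+1}` depends on the data, and is covered as
follows. Its penalties change it by `O(X)` only, which costs a factor that does not depend on `H`
and is not iterated, because the regression error is not compared with the true values but with
`P_h V_{h+1}` for the estimated `V_{h+1}`. Without penalties it is the truncated greedy value of a
linear score `⟨φ, u⟩` with `‖u‖ ≤ 2 H √N`. A union bound over a grid of `(4HN + 1)^d` scores of mesh
`1/√N` then suffices (`IsRegularData.subOpt_le`, `exists_isRegularData`).

*A single observation.* For `N = 1` and a small `X` necessarily `d = H = 1`, and `L = log (1/δ)` may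
be arbitrarily small, so that concentration is useless. But then the output is exactly optimal once
the observed reward is not small (`subOpt_nonpos_of_lt`), the probability of which is at least
`Cσ |θ|` up to the penalties, and policies differ by at most `|θ|` (`exists_event_single`).
-/

namespace PARTED

/-! ### Rollouts and the Bellman equation -/

attribute [instance] MDP.markov_P MDP.markov_rew Policy.markov_act

section Rollout

variable {S A : Type*} [MeasurableSpace S] [MeasurableSpace A]

lemma measurable_cons {X : Type*} [MeasurableSpace X] (n : ℕ) :
    Measurable (fun p : X × (Fin n → X) => (Fin.cons p.1 p.2 : Fin (n + 1) → X)) := by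
  refine measurable_pi_iff.2 fun i => ?_
  refine Fin.cases ?_ (fun j => ?_) i
  · simpa using measurable_fst
  · simpa using (show Measurable fun p : X × (Fin n → X) => p.2 j by fun_prop)

lemma measurable_cons_step (n : ℕ) :
    Measurable (fun p : (S × A) × (ℝ × (Fin n → (S × A) × ℝ)) =>
      (Fin.cons (p.1, p.2.1) p.2.2 : Fin (n + 1) → (S × A) × ℝ)) :=
  (measurable_cons (X := (S × A) × ℝ) n).comp
    (f := fun p : (S × A) × (ℝ × (Fin n → (S × A) × ℝ)) => ((p.1, p.2.1), p.2.2)) (by fun_prop)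

instance isMarkovKernel_rollout (M : MDP S A) (π : Policy S A) (n h : ℕ) :
    IsMarkovKernel (rollout M π n h) := by
  induction n generalizing h with
  | zero => unfold rollout; infer_instance
  | succ n ih =>
    have := ih (h + 1)
    unfold rollout
    exact Kernel.IsMarkovKernel.map _ (measurable_cons_step n)

lemma integrable_of_abs_le {X : Type*} [MeasurableSpace X] {ρ : Measure X} [IsFiniteMeasure ρ]
    {F : X → ℝ} (hF : Measurable F) {B : ℝ} (hB : ∀ x, |F x| ≤ B) : Integrable F ρ :=
  Integrable.of_bound hF.aestronglyMeasurable B (Filter.Eventually.of_forall hB)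

lemma abs_integral_le {X : Type*} [MeasurableSpace X] {ρ : Measure X} [IsProbabilityMeasure ρ]
    {F : X → ℝ} {B : ℝ} (hB : ∀ x, |F x| ≤ B) : |∫ x, F x ∂ρ| ≤ B := by
  simpa using norm_integral_le_of_norm_le_const (μ := ρ) (f := F) (Filter.Eventually.of_forall hB)

/-- The first step of a rollout, for bounded measurable functions, so that no integrability of the
inner integrals has to be tracked. -/
lemma integral_rollout_succ (M : MDP S A) (π : Policy S A) (n h : ℕ) (s : S)
    {F : (Fin (n + 1) → (S × A) × ℝ) → ℝ} (hF : Measurable F) {B : ℝ} (hB : ∀ ω, |F ω| ≤ B) :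
    ∫ ω, F ω ∂(rollout M π (n + 1) h s) =
      ∫ a, ∫ r, ∫ s', ∫ ω, F (Fin.cons ((s, a), r) ω) ∂(rollout M π n (h + 1) s')
        ∂(M.P h (s, a)) ∂(M.rew h (s, a)) ∂(π.act h s) := by
  have hm := measurable_cons_step (S := S) (A := A) n
  rw [rollout, Kernel.map_apply _ hm, integral_map hm.aemeasurable hF.aestronglyMeasurable,
    Kernel.integral_comp (f := fun p : (S × A) × (ℝ × (Fin n → (S × A) × ℝ)) =>
      F (Fin.cons (p.1, p.2.1) p.2.2))
      (integrable_of_abs_le (hF.comp hm) fun _ => hB _),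
    Kernel.prod_apply, Kernel.id_apply, Measure.dirac_prod,
    integral_map (by fun_prop)]
  · congr 1
    ext a
    rw [Kernel.prod_apply, Kernel.id_apply, Measure.dirac_prod, integral_map
      (f := fun p : (S × A) × (ℝ × (Fin n → (S × A) × ℝ)) => F (Fin.cons (p.1, p.2.1) p.2.2))
      (by fun_prop) (hF.comp hm).aestronglyMeasurable, Kernel.prod_apply, integral_prod]
    · congr 1
      ext r
      rw [Kernel.integral_comp]
      refine integrable_of_abs_le (B := B) ?_ fun _ => hB _
      exact hF.comp (hm.comp (by fun_prop))
    · refine integrable_of_abs_le (B := B) ?_ fun _ => hB _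
      exact hF.comp (hm.comp (by fun_prop))
  · refine (StronglyMeasurable.integral_kernel ?_).aestronglyMeasurable
    exact (hF.comp hm).stronglyMeasurable

lemma ae_rollout_succ (M : MDP S A) (π : Policy S A) (n h : ℕ) (s : S)
    {p : (Fin (n + 1) → (S × A) × ℝ) → Prop} (hp : MeasurableSet {ω | p ω})
    (H : ∀ a, ∀ᵐ r ∂(M.rew h (s, a)), ∀ s', ∀ᵐ ω ∂(rollout M π n (h + 1) s'),
      p (Fin.cons ((s, a), r) ω)) :
    ∀ᵐ ω ∂(rollout M π (n + 1) h s), p ω := by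
  have hF : Measurable ({ω | p ω}ᶜ.indicator (1 : (Fin (n + 1) → (S × A) × ℝ) → ℝ)) :=
    measurable_one.indicator hp.compl
  have h0 := integral_rollout_succ M π n h s hF (B := 1) (fun ω => by
    by_cases hω : p ω <;> simp [Set.indicator, hω])
  rw [integral_indicator_one hp.compl] at h0
  have h1 : ∀ a, ∫ r, ∫ s', ∫ ω, {ω | p ω}ᶜ.indicator (1 : (Fin (n + 1) → (S × A) × ℝ) → ℝ) (Fin.cons ((s, a), r) ω)
      ∂(rollout M π n (h + 1) s') ∂(M.P h (s, a)) ∂(M.rew h (s, a)) = 0 := by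
    intro a
    refine integral_eq_zero_of_ae ?_
    filter_upwards [H a] with r hr
    refine integral_eq_zero_of_ae (Filter.Eventually.of_forall fun s' => ?_)
    refine integral_eq_zero_of_ae ?_
    filter_upwards [hr s'] with ω hω
    simp [Set.indicator, hω]
  simp only [h1, integral_zero] at h0
  rw [ae_iff]
  exact (measureReal_eq_zero_iff (measure_ne_top _ _)).1 h0

lemma ae_reward_mem (M : MDP S A) (π : Policy S A) (n h : ℕ) (s : S) :
    ∀ᵐ ω ∂(rollout M π n h s), ∀ i, (ω i).2 ∈ Set.Icc (0 : ℝ) 1 := by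
  induction n generalizing h s with
  | zero => exact Filter.Eventually.of_forall fun ω i => i.elim0
  | succ n ih =>
    refine ae_rollout_succ M π n h s ?_ fun a => ?_
    · rw [Set.ofPred_forall]
      refine MeasurableSet.iInter fun i => ?_
      exact measurableSet_Icc.preimage (measurable_snd.comp (measurable_pi_apply i))
    · filter_upwards [M.rew_mem h (s, a)] with r hr s'
      filter_upwards [ih (h + 1) s'] with ω hω i
      refine Fin.cases ?_ (fun j => ?_) i
      · simpa using hr
      · simpa using hω j

/-- The projection of `x` to the interval `[0, b]`. -/
noncomputable def clip (b x : ℝ) : ℝ := max (min x b) 0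

lemma measurable_clip (b : ℝ) : Measurable (clip b) := by unfold clip; fun_prop

lemma clip_nonneg (b x : ℝ) : 0 ≤ clip b x := le_max_right _ _

lemma clip_le {b : ℝ} (hb : 0 ≤ b) (x : ℝ) : clip b x ≤ b := max_le (min_le_right _ _) hb

lemma clip_of_mem {b x : ℝ} (hx : x ∈ Set.Icc 0 b) : clip b x = x := by
  rw [clip, min_eq_left hx.2, max_eq_left hx.1]

lemma abs_clip_le {b : ℝ} (hb : 0 ≤ b) (x : ℝ) : |clip b x| ≤ b := by
  rw [abs_of_nonneg (clip_nonneg b x)]; exact clip_le hb x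

lemma abs_clip_sub_le (b x y : ℝ) : |clip b x - clip b y| ≤ |x - y| :=
  (abs_max_sub_max_le_abs _ _ _).trans <| by
    simpa using abs_min_sub_min_le_max x b y b

lemma abs_sum_clip_one_le {n : ℕ} (x : Fin n → ℝ) : |∑ i, clip 1 (x i)| ≤ n := by
  refine (Finset.abs_sum_le_sum_abs _ _).trans ?_
  simpa using Finset.sum_le_card_nsmul Finset.univ _ 1
    fun i _ => abs_clip_le zero_le_one (x i)

lemma meanReward_eq (M : MDP S A) (h : ℕ) (x : S × A) :
    M.meanReward h x = ∫ r, clip 1 r ∂(M.rew h x) :=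
  integral_congr_ae <| by
    filter_upwards [M.rew_mem h x] with r hr using (clip_of_mem hr).symm

lemma measurable_meanReward (M : MDP S A) (h : ℕ) : Measurable (M.meanReward h) :=
  (StronglyMeasurable.integral_kernel (κ := M.rew h)
    (stronglyMeasurable_id : StronglyMeasurable fun r : ℝ => r)).measurable

lemma meanReward_mem (M : MDP S A) (h : ℕ) (x : S × A) : M.meanReward h x ∈ Set.Icc (0 : ℝ) 1 := by
  rw [meanReward_eq]
  refine ⟨integral_nonneg fun r => clip_nonneg 1 r, ?_⟩
  exact (le_abs_self _).trans (abs_integral_le fun r => abs_clip_le zero_le_one r)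

/-- The expected sum of the rewards of the next `n` steps. -/
noncomputable def expReturn (M : MDP S A) (π : Policy S A) (n h : ℕ) (s : S) : ℝ :=
  ∫ ω, ∑ i, (ω i).2 ∂(rollout M π n h s)

lemma measurable_expReturn (M : MDP S A) (π : Policy S A) (n h : ℕ) :
    Measurable (expReturn M π n h) :=
  (StronglyMeasurable.integral_kernel (κ := rollout M π n h) (Measurable.stronglyMeasurable
    (f := fun ω : Fin n → (S × A) × ℝ => ∑ i, (ω i).2) (by fun_prop))).measurable

lemma expReturn_eq (M : MDP S A) (π : Policy S A) (n h : ℕ) (s : S) :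
    expReturn M π n h s = ∫ ω, ∑ i, clip 1 (ω i).2 ∂(rollout M π n h s) :=
  integral_congr_ae <| by
    filter_upwards [ae_reward_mem M π n h s] with ω hω
    exact Finset.sum_congr rfl fun i _ => (clip_of_mem (hω i)).symm

lemma expReturn_mem (M : MDP S A) (π : Policy S A) (n h : ℕ) (s : S) :
    expReturn M π n h s ∈ Set.Icc (0 : ℝ) n := by
  rw [expReturn_eq]
  refine ⟨integral_nonneg fun ω => Finset.sum_nonneg fun i _ => clip_nonneg _ _, ?_⟩
  exact (le_abs_self _).trans (abs_integral_le fun ω => abs_sum_clip_one_le fun i => (ω i).2)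

/-- The Bellman equation for the expected return. -/
lemma expReturn_succ (M : MDP S A) (π : Policy S A) (n h : ℕ) (s : S) :
    expReturn M π (n + 1) h s = ∫ a, (M.meanReward h (s, a) +
      ∫ s', expReturn M π n (h + 1) s' ∂(M.P h (s, a))) ∂(π.act h s) := by
  have hc := measurable_clip 1
  rw [expReturn_eq, integral_rollout_succ M π n h s (B := ((n + 1 : ℕ) : ℝ)) (by fun_prop)
    fun ω => abs_sum_clip_one_le fun i => (ω i).2]
  congr 1
  ext a
  have h1 : ∀ r s', ∫ ω, ∑ i, clip 1 ((Fin.cons ((s, a), r) ω : Fin (n + 1) → (S × A) × ℝ) i).2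
      ∂(rollout M π n (h + 1) s') = clip 1 r + expReturn M π n (h + 1) s' := by
    intro r s'
    simp only [Fin.sum_univ_succ, Fin.cons_zero, Fin.cons_succ]
    rw [integral_add (integrable_const _), expReturn_eq]
    · simp
    · exact integrable_of_abs_le (B := n) (by fun_prop) fun ω => abs_sum_clip_one_le fun i => (ω i).2
  have h2 : Integrable (fun s' => expReturn M π n (h + 1) s') (M.P h (s, a)) :=
    integrable_of_abs_le (B := n) (measurable_expReturn M π n (h + 1)) fun s' => by
      have := expReturn_mem M π n (h + 1) s'
      rw [abs_of_nonneg this.1]; exact this.2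
  simp only [h1]
  have h3 : ∀ r, ∫ s', (clip 1 r + expReturn M π n (h + 1) s') ∂(M.P h (s, a)) =
      clip 1 r + ∫ s', expReturn M π n (h + 1) s' ∂(M.P h (s, a)) := by
    intro r
    rw [integral_add (integrable_const _) h2]
    simp
  simp only [h3]
  rw [integral_add (integrable_of_abs_le hc fun r => abs_clip_le zero_le_one r)
    (integrable_const _), meanReward_eq]
  simp

/-- Given the present pair, the value of the next state has the conditional mean `P_h V`. -/
lemma integral_transition_noise (M : MDP S A) (π : Policy S A) {V : S → ℝ} (hV : Measurable V)
    {B : ℝ} (hVB : ∀ s, |V s| ≤ B) {g : S × A → ℝ} (hg : Measurable g) {G : ℝ}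
    (hgG : ∀ x, |g x| ≤ G) (n k i : ℕ) (hi : i + 1 < n) (s : S) :
    ∫ ω, g (ω ⟨i, by omega⟩).1 * (V (ω ⟨i + 1, hi⟩).1.1 -
      ∫ s', V s' ∂(M.P (k + i) (ω ⟨i, by omega⟩).1)) ∂(rollout M π n k s) = 0 := by
  have hPm : ∀ k, Measurable fun x => ∫ s', V s' ∂(M.P k x) := fun k =>
    (StronglyMeasurable.integral_kernel (κ := M.P k) hV.stronglyMeasurable).measurable
  have hPB : ∀ k x, |∫ s', V s' ∂(M.P k x)| ≤ B := fun k x => abs_integral_le hVB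
  have hb : ∀ k x s', |g x * (V s' - ∫ s', V s' ∂(M.P k x))| ≤ G * (B + B) := by
    intro k x s'
    rw [abs_mul]
    have hG : 0 ≤ G := (abs_nonneg _).trans (hgG x)
    exact mul_le_mul (hgG x) ((abs_sub _ _).trans (add_le_add (hVB s') (hPB k x)))
      (abs_nonneg _) hG
  induction n generalizing k i s with
  | zero => omega
  | succ n ih =>
    have hm : Measurable fun ω : Fin (n + 1) → (S × A) × ℝ =>
        g (ω ⟨i, by omega⟩).1 * (V (ω ⟨i + 1, hi⟩).1.1 -
          ∫ s', V s' ∂(M.P (k + i) (ω ⟨i, by omega⟩).1)) := by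
      have h1 : ∀ j : Fin (n + 1), Measurable fun ω : Fin (n + 1) → (S × A) × ℝ => (ω j).1 :=
        fun j => measurable_fst.comp (measurable_pi_apply j)
      exact (hg.comp (h1 _)).mul
        ((hV.comp (measurable_fst.comp (h1 _))).sub ((hPm (k + i)).comp (h1 _)))
    rw [integral_rollout_succ M π n k s hm fun ω => hb _ _ _]
    refine integral_eq_zero_of_ae (Filter.Eventually.of_forall fun a => ?_)
    refine integral_eq_zero_of_ae (Filter.Eventually.of_forall fun r => ?_)
    cases i with
    | succ i =>
      refine integral_eq_zero_of_ae (Filter.Eventually.of_forall fun s' => ?_)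
      have := ih (k + 1) i (by omega) s'
      rw [show k + 1 + i = k + (i + 1) by omega] at this
      exact this
    | zero =>
      obtain ⟨m, rfl⟩ : ∃ m, n = m + 1 := ⟨n - 1, by omega⟩
      have h1 : ∀ s', ∫ ω, g (s, a) * (V (ω 0).1.1 - ∫ s', V s' ∂(M.P k (s, a)))
          ∂(rollout M π (m + 1) (k + 1) s') = g (s, a) * (V s' - ∫ s', V s' ∂(M.P k (s, a))) := by
        intro s'
        rw [integral_rollout_succ M π m (k + 1) s' (by fun_prop) fun ω => hb _ _ _]
        simp
      refine Eq.trans (integral_congr_ae (Filter.Eventually.of_forall h1)) ?_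
      rw [integral_const_mul, integral_sub (integrable_of_abs_le hV hVB) (integrable_const _)]
      simp

/-- Given the whole sequence of pairs, each reward has the conditional mean `R_h(x_h)`. -/
lemma integral_reward_noise (M : MDP S A) (π : Policy S A) (n k : ℕ) (i : Fin n)
    {g : (Fin n → S × A) → ℝ} (hg : Measurable g) {G : ℝ} (hgG : ∀ x, |g x| ≤ G) (s : S) :
    ∫ ω, g (fun j => (ω j).1) * (clip 1 (ω i).2 - M.meanReward (k + i) (ω i).1)
      ∂(rollout M π n k s) = 0 := by
  have hc := measurable_clip 1
  have hb : ∀ y : ℝ, ∀ k x r, |y| ≤ G → |y * (clip 1 r - M.meanReward k x)| ≤ G * 1 := by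
    intro y k x r hy
    rw [abs_mul]
    have hG : 0 ≤ G := (abs_nonneg _).trans hy
    have h1 := meanReward_mem M k x
    have h2 := clip_nonneg 1 r
    have h3 := clip_le zero_le_one r
    exact mul_le_mul hy (abs_le.2 ⟨by linarith [h1.2], by linarith [h1.1]⟩) (abs_nonneg _) hG
  induction n generalizing k s with
  | zero => exact i.elim0
  | succ n ih =>
    have hm : Measurable fun ω : Fin (n + 1) → (S × A) × ℝ =>
        g (fun j => (ω j).1) * (clip 1 (ω i).2 - M.meanReward (k + i) (ω i).1) := by
      have := measurable_meanReward M (k + i)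
      fun_prop
    rw [integral_rollout_succ M π n k s hm fun ω => hb _ _ _ _ (hgG _)]
    refine integral_eq_zero_of_ae (Filter.Eventually.of_forall fun a => ?_)
    have hcons : ∀ (r : ℝ) (ω : Fin n → (S × A) × ℝ),
        (fun j => ((Fin.cons ((s, a), r) ω : Fin (n + 1) → (S × A) × ℝ) j).1) =
          (Fin.cons (s, a) (fun j => (ω j).1) : Fin (n + 1) → S × A) := by
      intro r ω
      ext1 j
      refine Fin.cases ?_ (fun j => ?_) j <;> simp
    have hgc : Measurable fun τ : Fin n → S × A => g (Fin.cons (s, a) τ) :=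
      hg.comp ((measurable_cons n).comp (f := fun τ => ((s, a), τ)) (by fun_prop))
    simp only [hcons]
    induction i using Fin.cases with
    | succ i =>
      refine integral_eq_zero_of_ae (Filter.Eventually.of_forall fun r => ?_)
      refine integral_eq_zero_of_ae (Filter.Eventually.of_forall fun s' => ?_)
      have := ih (k + 1) i hgc (fun _ => hgG _) s'
      rw [show k + 1 + (i : ℕ) = k + (i.succ : ℕ) by simp; omega] at this
      simpa using this
    | zero =>
      simp only [Fin.cons_zero, integral_mul_const, Fin.val_zero, add_zero]
      simp only [integral_const_mul]
      rw [integral_sub (integrable_of_abs_le hc fun r => abs_clip_le zero_le_one r)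
        (integrable_const _), meanReward_eq]
      simp

end Rollout

/-! ### The law of an episode -/

section EpisodeLaw

variable {S A : Type*} [MeasurableSpace S] [MeasurableSpace A]

lemma measurable_episode (n : ℕ) : Measurable (fun ω : Fin n → (S × A) × ℝ =>
    (((fun i => (ω i).1), ∑ i, (ω i).2) : Episode S A n)) := by fun_prop

instance isProbabilityMeasure_episodeLaw (M : MDP S A) (H : ℕ) (π : Policy S A) (ν₀ : Measure S)
    [IsProbabilityMeasure ν₀] : IsProbabilityMeasure (episodeLaw M H π ν₀) :=
  Measure.isProbabilityMeasure_map (measurable_episode H).aemeasurable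

lemma integral_episodeLaw (M : MDP S A) (H : ℕ) (π : Policy S A) (ν₀ : Measure S)
    [IsProbabilityMeasure ν₀] {F : Episode S A H → ℝ} (hF : Measurable F) {B : ℝ}
    (hB : ∀ e, |F e| ≤ B) :
    ∫ e, F e ∂(episodeLaw M H π ν₀) =
      ∫ s, ∫ ω, F (fun i => (ω i).1, ∑ i, (ω i).2) ∂(rollout M π H 0 s) ∂ν₀ := by
  have hm := measurable_episode (S := S) (A := A) H
  rw [episodeLaw, integral_map hm.aemeasurable hF.aestronglyMeasurable,
    Measure.comp_eq_comp_const_apply, Kernel.integral_comp, Kernel.const_apply]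
  exact integrable_of_abs_le (hF.comp hm) fun _ => hB _

lemma ae_return_mem (M : MDP S A) (H : ℕ) (π : Policy S A) (ν₀ : Measure S)
    [IsProbabilityMeasure ν₀] : ∀ᵐ e ∂(episodeLaw M H π ν₀), e.2 ∈ Set.Icc (0 : ℝ) H := by
  have hm := measurable_episode (S := S) (A := A) H
  have hs : MeasurableSet {e : Episode S A H | e.2 ∈ Set.Icc (0 : ℝ) H} :=
    measurable_snd measurableSet_Icc
  rw [episodeLaw, ae_map_iff hm.aemeasurable hs]
  refine Measure.ae_comp_of_ae_ae (hm hs) (Filter.Eventually.of_forall fun s => ?_)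
  filter_upwards [ae_reward_mem M π H 0 s] with ω hω
  refine ⟨Finset.sum_nonneg fun i _ => (hω i).1, ?_⟩
  simpa using Finset.sum_le_card_nsmul Finset.univ _ 1 fun i _ => (hω i).2

/-- The noise `r(τ) - ∑_h R_h(x_h)` of the trajectory reward is uncorrelated with every function
of the trajectory. -/
lemma integral_return_noise (M : MDP S A) (H : ℕ) (π : Policy S A) (ν₀ : Measure S)
    [IsProbabilityMeasure ν₀] {g : (Fin H → S × A) → ℝ} (hg : Measurable g) {G : ℝ}
    (hgG : ∀ x, |g x| ≤ G) :
    ∫ e, g e.1 * (clip H e.2 - ∑ h : Fin H, M.meanReward h (e.1 h)) ∂(episodeLaw M H π ν₀) = 0 := by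
  have hc := measurable_clip
  have hR := measurable_meanReward M
  have hRb : ∀ τ : Fin H → S × A, ∑ h : Fin H, M.meanReward h (τ h) ∈ Set.Icc (0 : ℝ) H := fun τ =>
    ⟨Finset.sum_nonneg fun i _ => (meanReward_mem M _ _).1, by
      simpa using Finset.sum_le_card_nsmul Finset.univ _ 1 fun (i : Fin H) _ =>
        (meanReward_mem M i (τ i)).2⟩
  rw [integral_episodeLaw M H π ν₀ (B := G * H) (by fun_prop)]
  · refine integral_eq_zero_of_ae (Filter.Eventually.of_forall fun s => ?_)
    have h1 : ∫ ω, g (fun i => (ω i).1) * (clip H (∑ i, (ω i).2) -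
        ∑ h : Fin H, M.meanReward h (ω h).1) ∂(rollout M π H 0 s) =
        ∫ ω, ∑ i : Fin H, g (fun i => (ω i).1) *
          (clip 1 (ω i).2 - M.meanReward (0 + i) (ω i).1) ∂(rollout M π H 0 s) := by
      refine integral_congr_ae ?_
      filter_upwards [ae_reward_mem M π H 0 s] with ω hω
      rw [← Finset.mul_sum, Finset.sum_sub_distrib, clip_of_mem]
      · simp only [clip_of_mem (hω _), zero_add]
      · refine ⟨Finset.sum_nonneg fun i _ => (hω i).1, ?_⟩
        simpa using Finset.sum_le_card_nsmul Finset.univ _ 1 fun i _ => (hω i).2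
    refine h1.trans ?_
    rw [integral_finsetSum]
    · exact Finset.sum_eq_zero fun i _ => integral_reward_noise M π H 0 i hg hgG s
    · intro i _
      refine integrable_of_abs_le (B := G * 1) (by fun_prop) fun ω => ?_
      rw [abs_mul]
      have h1 := meanReward_mem M (0 + i) (ω i).1
      have h2 := clip_nonneg 1 (ω i).2
      have h3 := clip_le zero_le_one (ω i).2
      exact mul_le_mul (hgG _) (abs_le.2 ⟨by linarith [h1.2], by linarith [h1.1]⟩) (abs_nonneg _)
        ((abs_nonneg _).trans (hgG fun i => (ω i).1))
  · intro e
    rw [abs_mul]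
    have h1 := hRb e.1
    have h2 := clip_nonneg H e.2
    have h3 := clip_le (Nat.cast_nonneg H) e.2
    exact mul_le_mul (hgG _) (abs_le.2 ⟨by linarith [h1.2], by linarith [h1.1]⟩) (abs_nonneg _)
      ((abs_nonneg _).trans (hgG e.1))

/-- The noise `V(s_{h+1}) - P_h V(x_h)` is uncorrelated with every function of `x_h`. -/
lemma integral_episode_transition_noise (M : MDP S A) (H : ℕ) (π : Policy S A) (ν₀ : Measure S)
    [IsProbabilityMeasure ν₀] {V : S → ℝ} (hV : Measurable V)
    {B : ℝ} (hVB : ∀ s, |V s| ≤ B) {g : S × A → ℝ} (hg : Measurable g) {G : ℝ}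
    (hgG : ∀ x, |g x| ≤ G) (h : Fin H) (hlt : h.val + 1 < H) :
    ∫ e, g (e.1 h) * (V (e.1 ⟨h.val + 1, hlt⟩).1 - ∫ s', V s' ∂(M.P h (e.1 h)))
      ∂(episodeLaw M H π ν₀) = 0 := by
  have hP : Measurable fun x => ∫ s', V s' ∂(M.P h x) :=
    (StronglyMeasurable.integral_kernel (κ := M.P h) hV.stronglyMeasurable).measurable
  rw [integral_episodeLaw M H π ν₀ (B := G * (B + B))]
  · refine integral_eq_zero_of_ae (Filter.Eventually.of_forall fun s => ?_)
    have := integral_transition_noise M π hV hVB hg hgG H 0 h hlt s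
    simp only [zero_add] at this
    exact this
  · have h1 : ∀ j : Fin H, Measurable fun e : Episode S A H => e.1 j := by fun_prop
    exact (hg.comp (h1 _)).mul ((hV.comp (measurable_fst.comp (h1 _))).sub (hP.comp (h1 _)))
  · intro e
    rw [abs_mul]
    exact mul_le_mul (hgG _) ((abs_sub _ _).trans (add_le_add (hVB _) (abs_integral_le hVB)))
      (abs_nonneg _) ((abs_nonneg _).trans (hgG (e.1 h)))

end EpisodeLaw

/-! ### Linear transitions -/

section Linear

variable {S A : Type*} [MeasurableSpace S] [MeasurableSpace A]

/-- The set function `B ↦ ∫_B ⟨v, w⟩ dν` is nonnegative off `Z`, hence so is the density almost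
everywhere, and `p` restricted to `Zᶜ` is `⟨v, w⟩ ν`. -/
lemma integral_eq_inner_of_density {d : ℕ} {p ν : Measure S} [IsProbabilityMeasure p] {Z : Set S}
    (hZ : MeasurableSet Z) {v : EuclideanSpace ℝ (Fin d)} {w : S → EuclideanSpace ℝ (Fin d)}
    (hw : Integrable w ν)
    (hp : ∀ B : Set S, MeasurableSet B → Disjoint B Z → p.real B = ∫ s in B, inner ℝ v (w s) ∂ν)
    {V : S → ℝ} (hV : Measurable V) {B : ℝ} (hVB : ∀ s, |V s| ≤ B) (hVZ : ∀ s ∈ Z, V s = 0) :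
    ∫ s, V s ∂p = inner ℝ v (∫ s in Zᶜ, V s • w s ∂ν) := by
  have hf : Integrable (fun s => inner ℝ v (w s)) ν := hw.const_inner v
  have hf0 : 0 ≤ᵐ[ν.restrict Zᶜ] fun s => inner ℝ v (w s) := by
    refine ae_nonneg_of_forall_setIntegral_nonneg hf.integrableOn fun B hB _ => ?_
    rw [Measure.restrict_restrict hB, ← hp _ (hB.inter hZ.compl)
      (Set.disjoint_left.2 fun x hx => hx.2)]
    exact measureReal_nonneg
  have hm : AEMeasurable (fun s => ENNReal.ofReal (inner ℝ v (w s))) (ν.restrict Zᶜ) :=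
    hf.aestronglyMeasurable.aemeasurable.ennreal_ofReal.restrict
  have hdens : p.restrict Zᶜ =
      (ν.restrict Zᶜ).withDensity (fun s => ENNReal.ofReal (inner ℝ v (w s))) := by
    ext B hB
    rw [Measure.restrict_apply hB, withDensity_apply _ hB, Measure.restrict_restrict hB,
      ← ofReal_integral_eq_lintegral_ofReal hf.integrableOn
        (ae_mono (Measure.restrict_mono Set.inter_subset_right le_rfl) hf0),
      ← hp _ (hB.inter hZ.compl) (Set.disjoint_left.2 fun x hx => hx.2),
      ofReal_measureReal]
  have h1 : ∫ s, V s ∂p = ∫ s in Zᶜ, V s ∂p :=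
    (setIntegral_eq_integral_of_forall_compl_eq_zero fun s hs => hVZ s (by simpa using hs)).symm
  rw [h1, hdens, integral_withDensity_eq_integral_toReal_smul₀ hm (by simp), ← integral_inner]
  · refine integral_congr_ae ?_
    filter_upwards [hf0] with s hs
    rw [ENNReal.toReal_ofReal hs, inner_smul_right, smul_eq_mul, mul_comm]
  · exact (hw.integrableOn (s := Zᶜ)).bdd_smul B hV.aestronglyMeasurable
      (Filter.Eventually.of_forall hVB)

/-- What the analysis uses of a linear MDP: mean rewards are linear in the feature, and so is
`P_h V` for every bounded `V` that vanishes on the null states. -/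
lemma IsLinearMDP.exists_params {d H : ℕ} {M : MDP S A} {Z : Set S}
    {φ : S × A → EuclideanSpace ℝ (Fin d)} (hM : IsLinearMDP M H Z φ) :
    ∃ θ : Fin H → EuclideanSpace ℝ (Fin d), (∀ h, ‖θ h‖ ≤ √(d : ℝ)) ∧
      (∀ (h : Fin H) x, M.meanReward h x = inner ℝ (φ x) (θ h)) ∧
      ∀ (h : Fin H) (V : S → ℝ) (B : ℝ), Measurable V → 0 ≤ B → (∀ s, |V s| ≤ B) →
        (∀ s ∈ Z, V s = 0) → ∃ w : EuclideanSpace ℝ (Fin d), ‖w‖ ≤ B * √(d : ℝ) ∧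
          ∀ x, ∫ s, V s ∂(M.P h x) = inner ℝ (φ x) w := by
  obtain ⟨hZ, -, -, -, ν, w, θ, hall⟩ := hM
  refine ⟨θ, fun h => (hall h).2.2.1, fun h => (hall h).2.2.2.2, ?_⟩
  intro h V B hV hB hVB hVZ
  obtain ⟨hw, hw1, -, hP, -⟩ := hall h
  refine ⟨∫ s in Zᶜ, V s • w h s ∂ν, ?_, fun x =>
    integral_eq_inner_of_density hZ hw (hP x) hV hVB hVZ⟩
  calc ‖∫ s in Zᶜ, V s • w h s ∂ν‖ ≤ ∫ s in Zᶜ, B * ‖w h s‖ ∂ν := by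
        refine norm_integral_le_of_norm_le (hw.norm.integrableOn.const_mul B) ?_
        refine Filter.Eventually.of_forall fun s => ?_
        rw [norm_smul]
        exact mul_le_mul_of_nonneg_right (hVB s) (norm_nonneg _)
    _ = B * ∫ s in Zᶜ, ‖w h s‖ ∂ν := integral_const_mul _ _
    _ ≤ B * √(d : ℝ) := by
        refine mul_le_mul_of_nonneg_left (le_trans ?_ hw1) hB
        exact setIntegral_le_integral hw.norm (Filter.Eventually.of_forall fun s => norm_nonneg _)

end Linear

/-! ### Planning with approximate Bellman backups -/

section Planning

variable {S A : Type*} [MeasurableSpace S] [MeasurableSpace A]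

lemma value_eq_expReturn (M : MDP S A) (H : ℕ) (π : Policy S A) (s : S) :
    value M H π 0 s = expReturn M π H 0 s := rfl

lemma integrable_expReturn (M : MDP S A) (π : Policy S A) (n h : ℕ) (p : Measure S)
    [IsProbabilityMeasure p] : Integrable (expReturn M π n h) p :=
  integrable_of_abs_le (B := n) (measurable_expReturn M π n h) fun s' => by
    have := expReturn_mem M π n h s'
    rw [abs_of_nonneg this.1]; exact this.2

lemma expReturn_zero (M : MDP S A) (π : Policy S A) (h : ℕ) (s : S) : expReturn M π 0 h s = 0 := by
  simp [expReturn]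

lemma integral_le_add {p : Measure S} [IsProbabilityMeasure p] {f g : S → ℝ} (hf : Integrable f p)
    (hg : Integrable g p) {c : ℝ} (hfg : ∀ s, f s ≤ g s + c) : ∫ s, f s ∂p ≤ ∫ s, g s ∂p + c := by
  refine (integral_mono hf (hg.add (integrable_const c)) hfg).trans_eq ?_
  rw [show (g + fun _ => c) = fun s => g s + c from rfl, integral_add hg (integrable_const c)]
  simp

lemma subOpt_le_of_forall (M : MDP S A) (H : ℕ) (πhat : Policy S A) (s : S) {b : ℝ}
    (hb : ∀ π : Policy S A, expReturn M π H 0 s ≤ expReturn M πhat H 0 s + b) :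
    subOpt M H πhat s ≤ b := by
  have : Nonempty (Policy S A) := ⟨πhat⟩
  have h1 : optValue M H s ≤ expReturn M πhat H 0 s + b := ciSup_le fun π => hb π
  rw [subOpt, value_eq_expReturn]
  linarith

lemma subOpt_le_horizon (M : MDP S A) (H : ℕ) (πhat : Policy S A) (s : S) :
    subOpt M H πhat s ≤ H :=
  subOpt_le_of_forall M H πhat s fun π => by
    linarith [(expReturn_mem M π H 0 s).2, (expReturn_mem M πhat H 0 s).1]

variable [Fintype A]

lemma policyAvg_mono (π : Policy S A) (h : ℕ) (s : S) {q q' : A → ℝ} (hq : ∀ a, q a ≤ q' a) :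
    policyAvg π h s q ≤ policyAvg π h s q' :=
  Finset.sum_le_sum fun a _ => mul_le_mul_of_nonneg_left (hq a) measureReal_nonneg

variable [MeasurableSingletonClass A]

lemma integral_act (π : Policy S A) (h : ℕ) (s : S) (q : A → ℝ) :
    ∫ a, q a ∂(π.act h s) = policyAvg π h s q := by
  rw [integral_fintype Integrable.of_finite]; rfl

lemma act_mem_stdSimplex (π : Policy S A) (h : ℕ) (s : S) :
    (fun a => (π.act h s).real {a}) ∈ stdSimplex ℝ A := by
  refine ⟨fun a => measureReal_nonneg, ?_⟩
  simp

lemma policyAvg_add_const (π : Policy S A) (h : ℕ) (s : S) (q : A → ℝ) (c : ℝ) :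
    policyAvg π h s (fun a => q a + c) = policyAvg π h s q + c := by
  simp only [policyAvg, mul_add, Finset.sum_add_distrib, ← Finset.sum_mul]
  rw [(act_mem_stdSimplex π h s).2, one_mul]

lemma expReturn_succ_eq_policyAvg (M : MDP S A) (π : Policy S A) (n h : ℕ) (s : S) :
    expReturn M π (n + 1) h s = policyAvg π h s (fun a => M.meanReward h (s, a) +
      ∫ s', expReturn M π n (h + 1) s' ∂(M.P h (s, a))) := by
  rw [expReturn_succ, integral_act]

/-- If no Bellman backup of `V` exceeds `Q` by more than `e`, and `V` is at least the greedy value of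
`Q`, then no policy beats `V` by more than `e` a step. -/
lemma expReturn_le_of_backup_le {H : ℕ} (M : MDP S A) (π : Policy S A) {Q : Fin H → S × A → ℝ}
    {V : Fin (H + 1) → S → ℝ} {e : ℝ} (hlast : ∀ s, V (Fin.last H) s = 0)
    (hVi : ∀ h : Fin (H + 1), ∀ p : Measure S, IsProbabilityMeasure p → Integrable (V h) p)
    (hQ : ∀ (h : Fin H) x, M.meanReward h x + ∫ s', V h.succ s' ∂(M.P h x) ≤ Q h x + e)
    (hgreedy : ∀ (h : Fin H) s, ∀ p ∈ stdSimplex ℝ A, ∑ a, p a * Q h (s, a) ≤ V h.castSucc s)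
    (n h : ℕ) (hn : h + n = H) (s : S) :
    expReturn M π n h s ≤ V ⟨h, by omega⟩ s + n * e := by
  induction n generalizing h s with
  | zero =>
    obtain rfl : h = H := by omega
    have := hlast s
    rw [Fin.last] at this
    simp [expReturn_zero, this]
  | succ n ih =>
    have hh : h < H := by omega
    rw [expReturn_succ_eq_policyAvg]
    have h1 : ∀ a, M.meanReward h (s, a) + ∫ s', expReturn M π n (h + 1) s' ∂(M.P h (s, a)) ≤
        Q ⟨h, hh⟩ (s, a) + (e + n * e) := by
      intro a
      have h2 := integral_le_add (p := M.P h (s, a)) (integrable_expReturn M π n (h + 1) _)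
        (hVi ⟨h + 1, by omega⟩ _ inferInstance) (fun s' => ih (h + 1) (by omega) s')
      have h3 := hQ ⟨h, hh⟩ (s, a)
      simp only [Fin.succ_mk] at h3
      linarith
    refine (policyAvg_mono π h s h1).trans ?_
    rw [policyAvg_add_const]
    have h4 := hgreedy ⟨h, hh⟩ s _ (act_mem_stdSimplex π h s)
    simp only [Fin.castSucc_mk] at h4
    have h5 : policyAvg π h s (fun a => Q ⟨h, hh⟩ (s, a)) ≤ V ⟨h, by omega⟩ s := h4
    push_cast
    linarith

/-- If no `Q` exceeds the Bellman backup of `V` by more than `e`, and `V` is the average of `Q` under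
`π`, then `π` falls short of `V` by at most `e` a step. -/
lemma le_expReturn_of_le_backup {H : ℕ} (M : MDP S A) (π : Policy S A) {Q : Fin H → S × A → ℝ}
    {V : Fin (H + 1) → S → ℝ} {e : ℝ} (hlast : ∀ s, V (Fin.last H) s = 0)
    (hVi : ∀ h : Fin (H + 1), ∀ p : Measure S, IsProbabilityMeasure p → Integrable (V h) p)
    (hQ : ∀ (h : Fin H) x, Q h x ≤ M.meanReward h x + ∫ s', V h.succ s' ∂(M.P h x) + e)
    (hV : ∀ (h : Fin H) s, V h.castSucc s = policyAvg π h s (fun a => Q h (s, a)))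
    (n h : ℕ) (hn : h + n = H) (s : S) :
    V ⟨h, by omega⟩ s ≤ expReturn M π n h s + n * e := by
  induction n generalizing h s with
  | zero =>
    obtain rfl : h = H := by omega
    have := hlast s
    rw [Fin.last] at this
    simp [expReturn_zero, this]
  | succ n ih =>
    have hh : h < H := by omega
    rw [expReturn_succ_eq_policyAvg]
    have h1 : ∀ a, Q ⟨h, hh⟩ (s, a) ≤ (M.meanReward h (s, a) +
        ∫ s', expReturn M π n (h + 1) s' ∂(M.P h (s, a))) + (e + n * e) := by
      intro a
      have h2 := integral_le_add (p := M.P h (s, a)) (hVi ⟨h + 1, by omega⟩ _ inferInstance)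
        (integrable_expReturn M π n (h + 1) _) (fun s' => ih (h + 1) (by omega) s')
      have h3 := hQ ⟨h, hh⟩ (s, a)
      simp only [Fin.succ_mk] at h3
      linarith
    have h4 := hV ⟨h, hh⟩ s
    simp only [Fin.castSucc_mk] at h4
    rw [h4]
    refine (policyAvg_mono π h s h1).trans ?_
    rw [policyAvg_add_const]
    push_cast
    linarith

/-- If `Q_h` is within `e` of the Bellman backup of `V_{h+1}` at every step, the greedy policy loses
at most `2 H e`. -/
lemma subOpt_le_of_abs_backup_le {H : ℕ} (M : MDP S A) (πhat : Policy S A)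
    {Q : Fin H → S × A → ℝ}
    {V : Fin (H + 1) → S → ℝ} {e : ℝ} (hlast : ∀ s, V (Fin.last H) s = 0)
    (hVi : ∀ h : Fin (H + 1), ∀ p : Measure S, IsProbabilityMeasure p → Integrable (V h) p)
    (hQ : ∀ (h : Fin H) x, |M.meanReward h x + ∫ s', V h.succ s' ∂(M.P h x) - Q h x| ≤ e)
    (hgreedy : ∀ (h : Fin H) s, ∀ p ∈ stdSimplex ℝ A,
      ∑ a, p a * Q h (s, a) ≤ policyAvg πhat h s (fun a => Q h (s, a)))
    (hV : ∀ (h : Fin H) s, V h.castSucc s = policyAvg πhat h s (fun a => Q h (s, a))) (s : S) :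
    subOpt M H πhat s ≤ 2 * H * e := by
  refine subOpt_le_of_forall M H πhat s fun π => ?_
  have h1 := expReturn_le_of_backup_le M π (Q := Q) (e := e) hlast hVi
    (fun h x => by linarith [(abs_le.1 (hQ h x)).2])
    (fun h s p hp => (hV h s).symm ▸ hgreedy h s p hp) H 0 (zero_add H) s
  have h2 := le_expReturn_of_le_backup M πhat (Q := Q) (e := e) hlast hVi
    (fun h x => by linarith [(abs_le.1 (hQ h x)).1]) hV H 0 (zero_add H) s
  linarith

end Planning

/-! ### Ridge regression, quadratic forms and Hoeffding's inequality -/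

section Ridge

variable {E ι : Type*} [NormedAddCommGroup E] [InnerProductSpace ℝ E] [Fintype ι]
  {x : ι → E} {y : ι → ℝ} {w : E}

/-- The normal equations of ridge regression. -/
lemma ridge_normal_eq
    (hmin : ∀ w', ∑ i, (y i - inner ℝ (x i) w) ^ 2 + ‖w‖ ^ 2 ≤
      ∑ i, (y i - inner ℝ (x i) w') ^ 2 + ‖w'‖ ^ 2) (v : E) :
    ∑ i, (y i - inner ℝ (x i) w) * inner ℝ (x i) v = inner ℝ w v := by
  set b := ∑ i, (y i - inner ℝ (x i) w) * inner ℝ (x i) v - inner ℝ w v with hb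
  set a := ∑ i, inner ℝ (x i) v ^ 2 + ‖v‖ ^ 2 with ha
  have hquad : ∀ t : ℝ, 0 ≤ a * (t * t) + (-2 * b) * t + 0 := by
    intro t
    have h := hmin (w + t • v)
    have h1 : ∑ i, (y i - inner ℝ (x i) (w + t • v)) ^ 2 = ∑ i, (y i - inner ℝ (x i) w) ^ 2 -
        2 * t * ∑ i, (y i - inner ℝ (x i) w) * inner ℝ (x i) v +
        t ^ 2 * ∑ i, inner ℝ (x i) v ^ 2 := by
      rw [Finset.mul_sum, Finset.mul_sum, ← Finset.sum_sub_distrib, ← Finset.sum_add_distrib]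
      refine Finset.sum_congr rfl fun i _ => ?_
      rw [inner_add_right, inner_smul_right]
      ring
    have h2 : ‖w + t • v‖ ^ 2 = ‖w‖ ^ 2 + 2 * t * inner ℝ w v + t ^ 2 * ‖v‖ ^ 2 := by
      rw [norm_add_sq_real, inner_smul_right, norm_smul, mul_pow, Real.norm_eq_abs, sq_abs]
      ring
    rw [h1, h2] at h
    rw [ha, hb]
    linarith
  have hd := discrim_le_zero hquad
  rw [discrim] at hd
  have hb0 : b = 0 := by nlinarith [sq_nonneg b]
  linarith

/-- The error of ridge regression, when the empirical second moment of the covariates is at least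
`c`: the noise enters through `∑ i, ε i • x i`, the regularization through `‖w'‖`. -/
lemma ridge_error_le
    (hmin : ∀ w', ∑ i, (y i - inner ℝ (x i) w) ^ 2 + ‖w‖ ^ 2 ≤
      ∑ i, (y i - inner ℝ (x i) w') ^ 2 + ‖w'‖ ^ 2) {c : ℝ}
    (hc : ∀ v, c * ‖v‖ ^ 2 ≤ ∑ i, inner ℝ (x i) v ^ 2) (w' : E) :
    c * ‖w - w'‖ ≤ ‖∑ i, (y i - inner ℝ (x i) w') • x i‖ + ‖w'‖ := by
  set v := w - w' with hv
  have hw : w = w' + v := by rw [hv]; abel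
  have h1 := ridge_normal_eq hmin v
  have h2 : ∑ i, (y i - inner ℝ (x i) w) * inner ℝ (x i) v =
      inner ℝ (∑ i, (y i - inner ℝ (x i) w') • x i) v - ∑ i, inner ℝ (x i) v ^ 2 := by
    rw [sum_inner, ← Finset.sum_sub_distrib]
    refine Finset.sum_congr rfl fun i _ => ?_
    rw [hw, inner_add_right, real_inner_smul_left]
    ring
  have h3 : inner ℝ w v = inner ℝ w' v + ‖v‖ ^ 2 := by
    rw [hw, inner_add_left, real_inner_self_eq_norm_sq]
  have h4 := real_inner_le_norm (∑ i, (y i - inner ℝ (x i) w') • x i) v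
  have h5 := (abs_le.1 (abs_real_inner_le_norm w' v)).1
  have h6 := hc v
  rcases (norm_nonneg v).eq_or_lt with h0 | h0
  · rw [← h0, mul_zero]; positivity
  · refine le_of_mul_le_mul_right ?_ h0
    nlinarith [sq_nonneg ‖v‖]

lemma ridge_norm_sq_le
    (hmin : ∀ w', ∑ i, (y i - inner ℝ (x i) w) ^ 2 + ‖w‖ ^ 2 ≤
      ∑ i, (y i - inner ℝ (x i) w') ^ 2 + ‖w'‖ ^ 2) : ‖w‖ ^ 2 ≤ ∑ i, y i ^ 2 := by
  have h := hmin 0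
  simp only [inner_zero_right, sub_zero, norm_zero] at h
  have : 0 ≤ ∑ i, (y i - inner ℝ (x i) w) ^ 2 := Finset.sum_nonneg fun i _ => sq_nonneg _
  linarith

end Ridge

section Quadratic

variable {κ : Type*} [Fintype κ]

/-- With `v = M⁻¹ u`, this follows from `c ⟨v, v⟩ ≤ ⟨u, v⟩` and `0 ≤ ‖u - c v‖²`; symmetry of `M` is
not needed. -/
lemma dotProduct_inv_mulVec_le [DecidableEq κ] {M : Matrix κ κ ℝ} {c : ℝ} (hc : 0 < c)
    (hM : ∀ v, c * (v ⬝ᵥ v) ≤ v ⬝ᵥ M.mulVec v) (u : κ → ℝ) :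
    u ⬝ᵥ M⁻¹.mulVec u ≤ (u ⬝ᵥ u) / c := by
  have hinj : Function.Injective M.mulVec := by
    intro v v' hvv
    have h0 : M.mulVec (v - v') = 0 := by rw [Matrix.mulVec_sub]; exact sub_eq_zero.2 hvv
    have h1 := hM (v - v')
    rw [h0, dotProduct_zero] at h1
    have h2 : 0 ≤ (v - v') ⬝ᵥ (v - v') := dotProduct_self_star_nonneg _
    have h3 : (v - v') ⬝ᵥ (v - v') = 0 := by nlinarith
    exact sub_eq_zero.1 (dotProduct_self_eq_zero.1 h3)
  have hdet : IsUnit M.det := (Matrix.isUnit_iff_isUnit_det M).1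
    (Matrix.mulVec_injective_iff_isUnit.1 hinj)
  set v := M⁻¹.mulVec u with hv
  have hMv : M.mulVec v = u := by
    rw [hv, Matrix.mulVec_mulVec, Matrix.mul_nonsing_inv _ hdet, Matrix.one_mulVec]
  have h1 := hM v
  rw [hMv, dotProduct_comm v u] at h1
  have h2 : 0 ≤ (u - c • v) ⬝ᵥ (u - c • v) := dotProduct_self_star_nonneg _
  have h3 : (u - c • v) ⬝ᵥ (u - c • v) = u ⬝ᵥ u - 2 * c * (u ⬝ᵥ v) + c ^ 2 * (v ⬝ᵥ v) := by
    simp only [sub_dotProduct, dotProduct_sub, smul_dotProduct, dotProduct_smul, smul_eq_mul,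
      dotProduct_comm v u]
    ring
  rw [le_div_iff₀ hc]
  nlinarith

lemma MinEigenvalueGE.le_dotProduct [DecidableEq κ] {M : Matrix κ κ ℝ} {c : ℝ}
    (hM : MinEigenvalueGE M c) (v : κ → ℝ) : c * (v ⬝ᵥ v) ≤ v ⬝ᵥ M.mulVec v := by
  have h := hM.dotProduct_mulVec_nonneg v
  rw [Matrix.sub_mulVec, Matrix.smul_mulVec, Matrix.one_mulVec, dotProduct_sub,
    dotProduct_smul, smul_eq_mul] at h
  simpa using h

lemma dotProduct_sum_vecMulVec {ι : Type*} [Fintype ι] (x : ι → κ → ℝ) (v : κ → ℝ) :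
    v ⬝ᵥ (∑ i, Matrix.vecMulVec (x i) (x i)).mulVec v = ∑ i, (x i ⬝ᵥ v) ^ 2 := by
  rw [Matrix.sum_mulVec, dotProduct_sum]
  refine Finset.sum_congr rfl fun i _ => ?_
  rw [Matrix.vecMulVec_mulVec, dotProduct_smul, dotProduct_comm v]
  simp [sq]

/-- An empirical second moment that is entrywise close to the true one inherits the lower bound on
its quadratic form. -/
lemma le_sum_sq_dotProduct {N : ℕ} {x : Fin N → κ → ℝ} {M : Matrix κ κ ℝ} {c t : ℝ}
    (hM : ∀ v, c * (v ⬝ᵥ v) ≤ v ⬝ᵥ M.mulVec v)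
    (hdev : ∀ p q, |∑ i, (x i p * x i q - M p q)| ≤ t) (v : κ → ℝ) :
    (N * c - t * Fintype.card κ) * (v ⬝ᵥ v) ≤ ∑ i, (x i ⬝ᵥ v) ^ 2 := by
  have h1 : ∑ i, (x i ⬝ᵥ v) ^ 2 - N * (v ⬝ᵥ M.mulVec v) =
      ∑ p, ∑ q, v p * v q * ∑ i, (x i p * x i q - M p q) := by
    have h2 : ∑ i, (x i ⬝ᵥ v) ^ 2 = ∑ p, ∑ q, v p * v q * ∑ i, x i p * x i q := by
      have h : ∀ i, (x i ⬝ᵥ v) ^ 2 = ∑ p, ∑ q, v p * v q * (x i p * x i q) := by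
        intro i
        rw [sq, dotProduct, Finset.sum_mul_sum]
        exact Finset.sum_congr rfl fun p _ => Finset.sum_congr rfl fun q _ => by ring
      simp only [h, Finset.mul_sum]
      rw [Finset.sum_comm]
      exact Finset.sum_congr rfl fun p _ => Finset.sum_comm
    have h3 : v ⬝ᵥ M.mulVec v = ∑ p, ∑ q, v p * v q * M p q := by
      simp only [dotProduct, Matrix.mulVec, Finset.mul_sum]
      exact Finset.sum_congr rfl fun p _ => Finset.sum_congr rfl fun q _ => by ring
    rw [h2, h3]
    simp only [Finset.sum_sub_distrib, mul_sub, Finset.sum_const, Finset.card_univ,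
      Fintype.card_fin, nsmul_eq_mul, Finset.mul_sum]
    congr 1
    exact Finset.sum_congr rfl fun p _ => Finset.sum_congr rfl fun q _ => by ring
  have h4 : |∑ p, ∑ q, v p * v q * ∑ i, (x i p * x i q - M p q)| ≤ t * (∑ p, |v p|) ^ 2 := by
    rw [sq, Finset.sum_mul_sum, Finset.mul_sum]
    refine (Finset.abs_sum_le_sum_abs _ _).trans (Finset.sum_le_sum fun p _ => ?_)
    rw [Finset.mul_sum]
    refine (Finset.abs_sum_le_sum_abs _ _).trans (Finset.sum_le_sum fun q _ => ?_)
    rw [abs_mul, abs_mul, mul_comm t]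
    exact mul_le_mul_of_nonneg_left (hdev p q) (by positivity)
  have h5 : (∑ p, |v p|) ^ 2 ≤ Fintype.card κ * (v ⬝ᵥ v) := by
    have := sq_sum_le_card_mul_sum_sq (s := Finset.univ) (f := fun p => |v p|)
    simpa [dotProduct, sq] using this
  have h6 := mul_le_mul_of_nonneg_left (hM v) (Nat.cast_nonneg (α := ℝ) N)
  -- `0 ≤ t` can be read off an entry, unless there is none
  rcases isEmpty_or_nonempty κ with hκ | ⟨⟨p⟩⟩
  · simp [dotProduct]
  have ht : 0 ≤ t := (abs_nonneg _).trans (hdev p p)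
  have h7 := mul_le_mul_of_nonneg_left h5 ht
  have h8 := (abs_le.1 h4).1
  nlinarith

end Quadratic

section Hoeffding

variable {Ω X : Type*} [MeasurableSpace Ω] [MeasurableSpace X] {Pr : Measure Ω}
  [IsProbabilityMeasure Pr] {N : ℕ} {D : Fin N → Ω → X} {ρ : Measure X}

/-- Hoeffding's inequality for one bounded centred function of i.i.d. observations. -/
lemma measureReal_le_sum_le (hD : ∀ i, Measurable (D i)) (hind : iIndepFun D Pr)
    (hρ : ∀ i, Measure.map (D i) Pr = ρ) {g : X → ℝ} (hg : Measurable g) {B : ℝ}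
    (hgB : ∀ x, |g x| ≤ B) (hg0 : ∫ x, g x ∂ρ = 0) {t : ℝ} (ht : 0 ≤ t) :
    Pr.real {ω | t ≤ ∑ i, g (D i ω)} ≤ Real.exp (-t ^ 2 / (2 * N * B ^ 2)) := by
  have hsub : ∀ i ∈ (Finset.univ : Finset (Fin N)),
      HasSubgaussianMGF (fun ω => g (D i ω)) ((‖B - -B‖₊ / 2) ^ 2) Pr := by
    intro i _
    refine hasSubgaussianMGF_of_mem_Icc_of_integral_eq_zero (hg.comp (hD i)).aemeasurable
      (Filter.Eventually.of_forall fun ω => abs_le.1 (hgB _)) ?_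
    rw [← integral_map (hD i).aemeasurable hg.aestronglyMeasurable, hρ i, hg0]
  have hind' : iIndepFun (fun i ω => g (D i ω)) Pr := hind.comp (fun _ => g) fun _ => hg
  refine (HasSubgaussianMGF.measure_sum_ge_le_of_iIndepFun hind' hsub ht).trans_eq ?_
  congr 2
  have h1 : (((‖B - -B‖₊ / 2) ^ 2 : NNReal) : ℝ) = B ^ 2 := by
    push_cast
    rw [Real.norm_eq_abs, div_pow, sq_abs]
    ring
  simp only [Finset.sum_const, Finset.card_univ, Fintype.card_fin, nsmul_eq_mul]
  push_cast at h1 ⊢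
  rw [h1]
  ring

/-- Hoeffding's inequality and a union bound, for finitely many bounded centred functions of i.i.d.
observations. -/
lemma measureReal_exists_lt_abs_sum_le {κ : Type*} [Fintype κ] (hD : ∀ i, Measurable (D i))
    (hind : iIndepFun D Pr)
    (hρ : ∀ i, Measure.map (D i) Pr = ρ) {g : κ → X → ℝ} (hg : ∀ k, Measurable (g k)) {B : ℝ}
    (hgB : ∀ k x, |g k x| ≤ B) (hg0 : ∀ k, ∫ x, g k x ∂ρ = 0) {t : ℝ} (ht : 0 ≤ t) :
    Pr.real {ω | ∃ k, t < |∑ i, g k (D i ω)|} ≤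
      Fintype.card κ * (2 * Real.exp (-t ^ 2 / (2 * N * B ^ 2))) := by
  have hsub : {ω | ∃ k, t < |∑ i, g k (D i ω)|} ⊆
      ⋃ k ∈ (Finset.univ : Finset κ), ({ω | t ≤ ∑ i, g k (D i ω)} ∪
        {ω | t ≤ ∑ i, -g k (D i ω)}) := by
    rintro ω ⟨k, hk⟩
    simp only [Finset.mem_univ, Set.iUnion_true, Set.mem_iUnion]
    refine ⟨k, ?_⟩
    rcases lt_abs.1 hk with h | h
    · exact Or.inl h.le
    · exact Or.inr (by simpa using h.le)
  refine (measureReal_mono hsub (measure_ne_top _ _)).trans ((measureReal_biUnion_finset_le _ _).trans ?_)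
  rw [← nsmul_eq_mul, ← Finset.card_univ]
  refine Finset.sum_le_card_nsmul _ _ _ fun k _ => ?_
  refine (measureReal_union_le _ _).trans ?_
  rw [two_mul]
  refine add_le_add (measureReal_le_sum_le hD hind hρ (hg k) (hgB k) (hg0 k) ht) ?_
  refine measureReal_le_sum_le hD hind hρ (hg k).neg (fun x => ?_) ?_ ht
  · simpa using hgB k x
  · simp [integral_neg, hg0 k]

lemma measurableSet_exists_lt_abs_sum {κ : Type*} [Countable κ] (hD : ∀ i, Measurable (D i))
    {g : κ → X → ℝ} (hg : ∀ k, Measurable (g k)) (t : ℝ) :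
    MeasurableSet {ω | ∃ k, t < |∑ i, g k (D i ω)|} := by
  rw [Set.ofPred_exists]
  refine MeasurableSet.iUnion fun k => measurableSet_lt measurable_const ?_
  have : ∀ i, Measurable fun ω => g k (D i ω) := fun i => (hg k).comp (hD i)
  exact (Finset.measurable_fun_sum _ fun i _ => this i).abs

end Hoeffding

/-! ### Greedy values of linear scores and a grid of scores -/

section GreedyValue

variable {S A : Type*} {d : ℕ}

/-- The value of the greedy action for the linear score `⟨φ(s, ·), u⟩`, truncated to `[0, b]`. -/
noncomputable def greedyValue (φ : S × A → EuclideanSpace ℝ (Fin d)) (b : ℝ)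
    (u : EuclideanSpace ℝ (Fin d)) (s : S) : ℝ :=
  ⨆ a, clip b (inner ℝ (φ (s, a)) u)

lemma abs_ciSup_sub_ciSup_le [Finite A] {f g : A → ℝ} {η : ℝ} (hη : 0 ≤ η)
    (hfg : ∀ a, |f a - g a| ≤ η) : |(⨆ a, f a) - ⨆ a, g a| ≤ η := by
  rcases isEmpty_or_nonempty A with hA | hA
  · simpa [Real.iSup_of_isEmpty] using hη
  · have h1 : (⨆ a, f a) ≤ (⨆ a, g a) + η := ciSup_le fun a => by
      linarith [(abs_le.1 (hfg a)).2, le_ciSup (Set.finite_range g).bddAbove a]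
    have h2 : (⨆ a, g a) ≤ (⨆ a, f a) + η := ciSup_le fun a => by
      linarith [(abs_le.1 (hfg a)).1, le_ciSup (Set.finite_range f).bddAbove a]
    exact abs_le.2 ⟨by linarith, by linarith⟩

variable {φ : S × A → EuclideanSpace ℝ (Fin d)}

lemma abs_greedyValue_le [Finite A] {b : ℝ} (hb : 0 ≤ b) (u : EuclideanSpace ℝ (Fin d)) (s : S) :
    |greedyValue φ b u s| ≤ b := by
  have := abs_ciSup_sub_ciSup_le (g := fun _ : A => (0 : ℝ)) hb
    (fun a => by simpa using abs_clip_le hb (inner ℝ (φ (s, a)) u))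
  simpa [greedyValue, Real.iSup_const_zero] using this

lemma abs_greedyValue_sub_le [Finite A] (hφ : ∀ x, ‖φ x‖ ≤ 1) (b : ℝ)
    (u u' : EuclideanSpace ℝ (Fin d)) (s : S) :
    |greedyValue φ b u s - greedyValue φ b u' s| ≤ ‖u - u'‖ := by
  refine abs_ciSup_sub_ciSup_le (norm_nonneg _) fun a => (abs_clip_sub_le _ _ _).trans ?_
  rw [← inner_sub_right]
  refine (abs_real_inner_le_norm _ _).trans ?_
  exact mul_le_of_le_one_left (norm_nonneg _) (hφ _)

lemma measurable_greedyValue [MeasurableSpace S] [MeasurableSpace A] [Finite A]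
    (hφ : Measurable φ) (b : ℝ) (u : EuclideanSpace ℝ (Fin d)) :
    Measurable (greedyValue φ b u) := by
  refine Measurable.iSup fun a => (measurable_clip b).comp ?_
  exact (hφ.comp (measurable_id.prodMk measurable_const)).inner measurable_const

end GreedyValue

section Net

variable {d : ℕ}

/-- The grid of mesh `ρ` in the cube of half-side `ρ n`. -/
noncomputable def netPoint (ρ : ℝ) (n : ℕ) (k : Fin d → Fin (2 * n + 1)) :
    EuclideanSpace ℝ (Fin d) :=
  WithLp.toLp 2 fun j => ρ * ((k j : ℕ) - (n : ℝ))

lemma norm_le_sqrt_card_mul {v : EuclideanSpace ℝ (Fin d)} {t : ℝ} (ht : 0 ≤ t)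
    (hv : ∀ j, |v j| ≤ t) : ‖v‖ ≤ √(d : ℝ) * t := by
  rw [EuclideanSpace.norm_eq, ← Real.sqrt_sq ht, ← Real.sqrt_mul (Nat.cast_nonneg d)]
  refine Real.sqrt_le_sqrt ?_
  have := Finset.sum_le_card_nsmul Finset.univ (fun j => ‖v j‖ ^ 2) (t ^ 2) fun j _ =>
    pow_le_pow_left₀ (norm_nonneg _) (hv j) 2
  simpa using this

/-- Every vector of norm at most `ρ n` is rounded down, coordinate by coordinate, to a grid point. -/
lemma exists_norm_sub_netPoint_le {ρ : ℝ} (hρ : 0 < ρ) {n : ℕ} {u : EuclideanSpace ℝ (Fin d)}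
    (hu : ‖u‖ ≤ ρ * n) : ∃ k, ‖u - netPoint ρ n k‖ ≤ √(d : ℝ) * ρ := by
  have hj : ∀ j, |u j / ρ| ≤ n := fun j => by
    rw [abs_div, abs_of_pos hρ, div_le_iff₀ hρ, mul_comm]
    exact (PiLp.norm_apply_le u j).trans hu
  have h0 : ∀ j, 0 ≤ ⌊u j / ρ⌋ + n := fun j => by
    have : -(n : ℤ) ≤ ⌊u j / ρ⌋ := Int.le_floor.2 (by push_cast; exact (abs_le.1 (hj j)).1)
    omega
  have h1 : ∀ j, ⌊u j / ρ⌋ ≤ n := fun j => by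
    have : ((⌊u j / ρ⌋ : ℤ) : ℝ) ≤ ((n : ℤ) : ℝ) := by
      push_cast
      exact (Int.floor_le _).trans (abs_le.1 (hj j)).2
    exact_mod_cast this
  refine ⟨fun j => ⟨(⌊u j / ρ⌋ + n).toNat, by have := h0 j; have := h1 j; omega⟩, ?_⟩
  refine norm_le_sqrt_card_mul hρ.le fun j => ?_
  have h2 : (((⌊u j / ρ⌋ + n).toNat : ℕ) : ℝ) = (⌊u j / ρ⌋ : ℝ) + n := by
    have : (((⌊u j / ρ⌋ + n).toNat : ℤ) : ℝ) = ((⌊u j / ρ⌋ + n : ℤ) : ℝ) := by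
      rw [Int.toNat_of_nonneg (h0 j)]
    push_cast at this
    exact_mod_cast this
  have h3 := Int.floor_le (u j / ρ)
  have h4 := Int.lt_floor_add_one (u j / ρ)
  have h5 : u j = ρ * (u j / ρ) := by field_simp
  simp only [PiLp.sub_apply, netPoint, h2, add_sub_cancel_right]
  rw [abs_le]
  constructor
  · nlinarith
  · nlinarith

end Net

section Output

variable {S A : Type*} [MeasurableSpace S] [MeasurableSpace A] {d H N : ℕ}
  {φ : S × A → EuclideanSpace ℝ (Fin d)}

lemma measurable_rewardPenalty (hφ : Measurable φ) (l₁ : ℝ) (D : Fin N → Episode S A H)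
    (h : Fin H) : Measurable (rewardPenalty φ l₁ D h) := by
  have h1 : ∀ p, Measurable fun x => oneBlockHot φ h x p := by
    intro p
    unfold oneBlockHot
    split_ifs <;> fun_prop
  unfold rewardPenalty dotProduct Matrix.mulVec dotProduct
  fun_prop

lemma measurable_valuePenalty (hφ : Measurable φ) (l₂ : ℝ) (D : Fin N → Episode S A H)
    (h : Fin H) : Measurable (valuePenalty φ l₂ D h) := by
  unfold valuePenalty dotProduct Matrix.mulVec dotProduct
  fun_prop

variable [Fintype A] [MeasurableSingletonClass A]

/-- The average of `q'` under a policy that is greedy for `q'` is close to the maximum of any `q`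
that is close to `q'`. -/
lemma abs_policyAvg_sub_ciSup_le (π : Policy S A) (h : ℕ) (s : S) {q q' : A → ℝ} {η : ℝ}
    (hq : ∀ a, |q' a - q a| ≤ η)
    (hgreedy : ∀ p ∈ stdSimplex ℝ A, ∑ a, p a * q' a ≤ policyAvg π h s q') :
    |policyAvg π h s q' - ⨆ a, q a| ≤ η := by
  classical
  have hA : Nonempty A := by
    by_contra hA
    rw [not_nonempty_iff] at hA
    have := (act_mem_stdSimplex π h s).2
    simp at this
  have h1 : (⨆ a, q a) ≤ policyAvg π h s q' + η := by
    refine ciSup_le fun a => ?_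
    have h2 := hgreedy _ (single_mem_stdSimplex ℝ a)
    have h3 : ∑ b, (Pi.single a (1 : ℝ) : A → ℝ) b * q' b = q' a := by
      rw [Finset.sum_eq_single a (fun b _ hb => by simp [hb]) (by simp)]
      simp
    linarith [(abs_le.1 (hq a)).1]
  have h2 : policyAvg π h s q' ≤ (⨆ a, q a) + η := by
    have := policyAvg_mono π h s (q := q') (q' := fun _ => 0 + ((⨆ a, q a) + η)) fun a => by
      linarith [(abs_le.1 (hq a)).2, le_ciSup (Set.finite_range q).bddAbove a]
    rw [policyAvg_add_const] at this
    simpa [policyAvg] using this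
  exact abs_le.2 ⟨by linarith, by linarith⟩

lemma measurable_policyAvg (π : Policy S A) (h : ℕ) {q : S × A → ℝ} (hq : Measurable q) :
    Measurable fun s => policyAvg π h s fun a => q (s, a) := by
  unfold policyAvg
  refine Finset.measurable_fun_sum _ fun a _ => Measurable.mul ?_ ?_
  · exact ((π.act h).measurable_coe (measurableSet_singleton a)).ennreal_toReal
  · exact hq.comp (measurable_id.prodMk measurable_const)

lemma policyAvg_mem_Icc (π : Policy S A) (h : ℕ) (s : S) {q : A → ℝ} {b : ℝ}
    (hq : ∀ a, q a ∈ Set.Icc 0 b) : policyAvg π h s q ∈ Set.Icc 0 b := by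
  refine ⟨Finset.sum_nonneg fun a _ => mul_nonneg measureReal_nonneg (hq a).1, ?_⟩
  have := policyAvg_mono π h s (q := q) (q' := fun _ => 0 + b) fun a => by simpa using (hq a).2
  rw [policyAvg_add_const] at this
  simpa [policyAvg] using this

end Output

/-! ### The two regressions of the algorithm -/

section Regression

variable {S A : Type*} {d H N : ℕ} {φ : S × A → EuclideanSpace ℝ (Fin d)}

/-- The trajectory feature as a vector of blocks, in the Euclidean norm of `ℝ^{dH}`. -/
noncomputable def stackedFeature (φ : S × A → EuclideanSpace ℝ (Fin d)) (τ : Fin H → S × A) :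
    PiLp 2 (fun _ : Fin H => EuclideanSpace ℝ (Fin d)) :=
  WithLp.toLp 2 fun h => φ (τ h)

lemma inner_eq_dotProduct (u v : EuclideanSpace ℝ (Fin d)) :
    inner ℝ u v = u.ofLp ⬝ᵥ v.ofLp := by
  rw [EuclideanSpace.inner_eq_star_dotProduct, dotProduct_comm]; simp

lemma norm_sq_eq_dotProduct (u : EuclideanSpace ℝ (Fin d)) : ‖u‖ ^ 2 = u.ofLp ⬝ᵥ u.ofLp := by
  rw [← real_inner_self_eq_norm_sq, inner_eq_dotProduct]

lemma inner_stackedFeature (τ : Fin H → S × A)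
    (Θ : PiLp 2 (fun _ : Fin H => EuclideanSpace ℝ (Fin d))) :
    inner ℝ (stackedFeature φ τ) Θ = ∑ h, inner ℝ (φ (τ h)) (Θ h) := by
  simp [stackedFeature, PiLp.inner_apply]

variable {D : Fin N → Episode S A H} {m : ℝ}

lemma mul_norm_sq_le_sum_inner_stackedFeature
    (hm : ∀ v : Fin H × Fin d → ℝ, m * (v ⬝ᵥ v) ≤ ∑ i, (trajFeature φ (D i).1 ⬝ᵥ v) ^ 2)
    (Θ : PiLp 2 (fun _ : Fin H => EuclideanSpace ℝ (Fin d))) :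
    m * ‖Θ‖ ^ 2 ≤ ∑ i, inner ℝ (stackedFeature φ (D i).1) Θ ^ 2 := by
  have h := hm fun p => Θ p.1 p.2
  have h1 : ‖Θ‖ ^ 2 = (fun p : Fin H × Fin d => Θ p.1 p.2) ⬝ᵥ (fun p => Θ p.1 p.2) := by
    rw [PiLp.norm_sq_eq_of_L2]
    simp only [norm_sq_eq_dotProduct, dotProduct, Fintype.sum_prod_type]
  rw [h1]
  refine h.trans_eq (Finset.sum_congr rfl fun i _ => ?_)
  rw [inner_stackedFeature]
  simp only [inner_eq_dotProduct, dotProduct, Fintype.sum_prod_type, trajFeature]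

/-- The quadratic form of a single step is a diagonal block of that of the trajectory. -/
lemma mul_norm_sq_le_sum_inner_feature
    (hm : ∀ v : Fin H × Fin d → ℝ, m * (v ⬝ᵥ v) ≤ ∑ i, (trajFeature φ (D i).1 ⬝ᵥ v) ^ 2)
    (h : Fin H) (v : EuclideanSpace ℝ (Fin d)) :
    m * ‖v‖ ^ 2 ≤ ∑ i, inner ℝ (φ ((D i).1 h)) v ^ 2 := by
  have h0 := hm fun p => if p.1 = h then v p.2 else 0
  simpa [norm_sq_eq_dotProduct, inner_eq_dotProduct, dotProduct, Fintype.sum_prod_type,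
    trajFeature, Finset.sum_comm (γ := Fin d)] using h0

lemma sqrt_dotProduct_inv_le {κ : Type*} [Fintype κ] [DecidableEq κ] {x : Fin N → κ → ℝ}
    (hm0 : 0 < m) (hm : ∀ v, m * (v ⬝ᵥ v) ≤ ∑ i, (x i ⬝ᵥ v) ^ 2) {u : κ → ℝ}
    (hu : u ⬝ᵥ u ≤ 1) :
    √(u ⬝ᵥ ((1 : ℝ) • (1 : Matrix κ κ ℝ) +
      ∑ i, Matrix.vecMulVec (x i) (x i))⁻¹.mulVec u) ≤ √(1 / m) := by
  refine Real.sqrt_le_sqrt ((dotProduct_inv_mulVec_le hm0 (fun v => ?_) u).trans ?_)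
  · rw [one_smul, Matrix.add_mulVec, Matrix.one_mulVec, dotProduct_add, dotProduct_sum_vecMulVec]
    have : 0 ≤ v ⬝ᵥ v := dotProduct_self_star_nonneg _
    linarith [hm v]
  · gcongr

/-- With `λ₁ = 1`, on data whose second moment is at least `m`, the penalties are at most `m^{-1/2}`. -/
lemma rewardPenalty_le (hφ : ∀ x, ‖φ x‖ ≤ 1) (hm0 : 0 < m)
    (hm : ∀ v : Fin H × Fin d → ℝ, m * (v ⬝ᵥ v) ≤ ∑ i, (trajFeature φ (D i).1 ⬝ᵥ v) ^ 2)
    (h : Fin H) (x : S × A) : rewardPenalty φ 1 D h x ≤ √(1 / m) := by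
  refine sqrt_dotProduct_inv_le hm0 hm ?_
  have h1 : oneBlockHot φ h x ⬝ᵥ oneBlockHot φ h x = ‖φ x‖ ^ 2 := by
    rw [norm_sq_eq_dotProduct]
    simp [oneBlockHot, dotProduct, Fintype.sum_prod_type]
  rw [h1]
  exact pow_le_one₀ (norm_nonneg _) (hφ x)

lemma valuePenalty_le (hφ : ∀ x, ‖φ x‖ ≤ 1) (hm0 : 0 < m)
    (hm : ∀ v : Fin H × Fin d → ℝ, m * (v ⬝ᵥ v) ≤ ∑ i, (trajFeature φ (D i).1 ⬝ᵥ v) ^ 2)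
    (h : Fin H) (x : S × A) : valuePenalty φ 1 D h x ≤ √(1 / m) := by
  refine sqrt_dotProduct_inv_le hm0 (fun v => ?_) ?_
  · have := mul_norm_sq_le_sum_inner_feature hm h (WithLp.toLp 2 v)
    simpa only [norm_sq_eq_dotProduct, inner_eq_dotProduct] using this
  · rw [← norm_sq_eq_dotProduct]
    exact pow_le_one₀ (norm_nonneg _) (hφ x)

lemma rewardLoss_eq (Θ : PiLp 2 (fun _ : Fin H => EuclideanSpace ℝ (Fin d))) :
    rewardLoss φ 1 D Θ.ofLp =
      ∑ i, ((D i).2 - inner ℝ (stackedFeature φ (D i).1) Θ) ^ 2 + ‖Θ‖ ^ 2 := by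
  rw [rewardLoss, one_mul, PiLp.norm_sq_eq_of_L2 (fun _ : Fin H => EuclideanSpace ℝ (Fin d))]
  congr 1
  refine Finset.sum_congr rfl fun i _ => ?_
  rw [inner_stackedFeature]
  ring

/-- The error of the reward redistribution, in terms of the noise of the trajectory rewards. -/
lemma norm_sub_le_of_rewardLoss_min {Θ : Fin H → EuclideanSpace ℝ (Fin d)}
    (hΘ : ∀ Θ', rewardLoss φ 1 D Θ ≤ rewardLoss φ 1 D Θ') (hm0 : 0 < m)
    (hm : ∀ v : Fin H × Fin d → ℝ, m * (v ⬝ᵥ v) ≤ ∑ i, (trajFeature φ (D i).1 ⬝ᵥ v) ^ 2)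
    {θ : Fin H → EuclideanSpace ℝ (Fin d)} (hθ : ∀ h, ‖θ h‖ ≤ √(d : ℝ)) {t : ℝ} (ht : 0 ≤ t)
    (hnoise : ∀ p, |∑ i, trajFeature φ (D i).1 p *
      ((D i).2 - ∑ h, inner ℝ (φ ((D i).1 h)) (θ h))| ≤ t) (h : Fin H) :
    ‖Θ h - θ h‖ ≤ √((H : ℝ) * d) * (t + 1) / m := by
  have hmin : ∀ Θ' : PiLp 2 (fun _ : Fin H => EuclideanSpace ℝ (Fin d)),
      ∑ i, ((D i).2 - inner ℝ (stackedFeature φ (D i).1) (WithLp.toLp 2 Θ)) ^ 2 +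
        ‖(WithLp.toLp 2 Θ : PiLp 2 (fun _ : Fin H => EuclideanSpace ℝ (Fin d)))‖ ^ 2 ≤
      ∑ i, ((D i).2 - inner ℝ (stackedFeature φ (D i).1) Θ') ^ 2 + ‖Θ'‖ ^ 2 := by
    intro Θ'
    rw [← rewardLoss_eq, ← rewardLoss_eq]
    exact hΘ Θ'.ofLp
  have h1 := ridge_error_le hmin (mul_norm_sq_le_sum_inner_stackedFeature hm) (WithLp.toLp 2 θ)
  have h2 : ‖(WithLp.toLp 2 θ : PiLp 2 (fun _ : Fin H => EuclideanSpace ℝ (Fin d)))‖ ≤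
      √((H : ℝ) * d) := by
    refine Real.le_sqrt_of_sq_le ?_
    rw [PiLp.norm_sq_eq_of_L2]
    have := Finset.sum_le_card_nsmul Finset.univ (fun h => ‖θ h‖ ^ 2) (d : ℝ) fun h _ => by
      have := pow_le_pow_left₀ (norm_nonneg _) (hθ h) 2
      rwa [Real.sq_sqrt (Nat.cast_nonneg d)] at this
    simpa using this
  have h3 : ‖∑ i, ((D i).2 - inner ℝ (stackedFeature φ (D i).1) (WithLp.toLp 2 θ)) •
      stackedFeature φ (D i).1‖ ≤ √((H : ℝ) * d) * t := by
    rw [← Real.sqrt_sq ht, ← Real.sqrt_mul (by positivity)]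
    refine Real.le_sqrt_of_sq_le ?_
    rw [PiLp.norm_sq_eq_of_L2]
    have h4 : ∀ h, ‖(∑ i, ((D i).2 - inner ℝ (stackedFeature φ (D i).1) (WithLp.toLp 2 θ)) •
        stackedFeature φ (D i).1) h‖ ^ 2 ≤ d * t ^ 2 := by
      intro h
      rw [EuclideanSpace.norm_sq_eq]
      have := Finset.sum_le_card_nsmul Finset.univ (fun j => ‖((∑ i, ((D i).2 -
        inner ℝ (stackedFeature φ (D i).1) (WithLp.toLp 2 θ)) •
        stackedFeature φ (D i).1) h) j‖ ^ 2) (t ^ 2) fun j _ => by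
          refine pow_le_pow_left₀ (norm_nonneg _) ?_ 2
          refine le_trans (le_of_eq ?_) (hnoise (h, j))
          rw [Real.norm_eq_abs]
          congr 1
          simp only [inner_stackedFeature]
          simp [stackedFeature, trajFeature, mul_comm]
      simpa using this
    have := Finset.sum_le_card_nsmul Finset.univ _ _ fun h _ => h4 h
    refine this.trans_eq ?_
    simp
    ring
  have h5 : ‖Θ h - θ h‖ ≤ ‖(WithLp.toLp 2 Θ : PiLp 2 (fun _ : Fin H => EuclideanSpace ℝ (Fin d))) -
      WithLp.toLp 2 θ‖ := by
    simpa using PiLp.norm_apply_le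
      ((WithLp.toLp 2 Θ : PiLp 2 (fun _ : Fin H => EuclideanSpace ℝ (Fin d))) - WithLp.toLp 2 θ) h
  rw [le_div_iff₀ hm0, mul_comm]
  refine (mul_le_mul_of_nonneg_left h5 hm0.le).trans (h1.trans ?_)
  linarith

/-- A crude bound on the estimates, from the comparison of the losses of `Θ` and of `0`; it bounds the
range that the grid of scores has to cover. -/
lemma norm_le_of_rewardLoss_min {Θ : Fin H → EuclideanSpace ℝ (Fin d)}
    (hΘ : ∀ Θ', rewardLoss φ 1 D Θ ≤ rewardLoss φ 1 D Θ') {B : ℝ} (hB : 0 ≤ B)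
    (hr : ∀ i, |(D i).2| ≤ B) (h : Fin H) : ‖Θ h‖ ≤ B * √(N : ℝ) := by
  have h1 := hΘ 0
  simp only [rewardLoss, one_mul, Pi.zero_apply, inner_zero_right, Finset.sum_const_zero,
    zero_sub, norm_zero, neg_sq] at h1
  have h2 : ‖Θ h‖ ^ 2 ≤ ∑ h, ‖Θ h‖ ^ 2 :=
    Finset.single_le_sum (f := fun h => ‖Θ h‖ ^ 2) (fun h _ => sq_nonneg _) (Finset.mem_univ h)
  have h3 : ∑ i, (D i).2 ^ 2 ≤ N * B ^ 2 := by
    have := Finset.sum_le_card_nsmul Finset.univ (fun i => (D i).2 ^ 2) (B ^ 2) fun i _ =>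
      sq_le_sq' (abs_le.1 (hr i)).1 (abs_le.1 (hr i)).2
    simpa using this
  have h4 : 0 ≤ ∑ i, ((∑ h, inner ℝ (φ ((D i).1 h)) (Θ h)) - (D i).2) ^ 2 :=
    Finset.sum_nonneg fun i _ => sq_nonneg _
  refine le_of_sq_le_sq ?_ (by positivity)
  rw [mul_pow, Real.sq_sqrt (Nat.cast_nonneg N)]
  simp at h1
  linarith

lemma norm_le_of_valueLoss_min {h : Fin H} {V : S → ℝ} {w : EuclideanSpace ℝ (Fin d)}
    (hw : ∀ w', valueLoss φ 1 D h V w ≤ valueLoss φ 1 D h V w') {B : ℝ} (hB : 0 ≤ B)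
    (hV : ∀ s, |V s| ≤ B) : ‖w‖ ≤ B * √(N : ℝ) := by
  have h1 := ridge_norm_sq_le (x := fun i => φ ((D i).1 h)) (y := fun i => nextValue V (D i).1 h)
    (w := w) (fun w' => by simpa only [valueLoss, one_mul] using hw w')
  have h2 : ∑ i, nextValue V (D i).1 h ^ 2 ≤ N * B ^ 2 := by
    have := Finset.sum_le_card_nsmul Finset.univ (fun i => nextValue V (D i).1 h ^ 2) (B ^ 2)
      fun i _ => by
        rw [nextValue]
        split_ifs
        · exact sq_le_sq' (abs_le.1 (hV _)).1 (abs_le.1 (hV _)).2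
        · simpa using sq_nonneg B
    simpa using this
  refine le_of_sq_le_sq ?_ (by positivity)
  rw [mul_pow, Real.sq_sqrt (Nat.cast_nonneg N)]
  linarith

lemma abs_sub_integral_sub_le [MeasurableSpace S] {p : Measure S} [IsProbabilityMeasure p] {V V' : S → ℝ}
    (hV : Integrable V p) (hV' : Integrable V' p) {η : ℝ} (hη : ∀ s, |V s - V' s| ≤ η) (s : S) :
    |(V s - ∫ s', V s' ∂p) - (V' s - ∫ s', V' s' ∂p)| ≤ 2 * η := by
  have h1 : |∫ s', (V s' - V' s') ∂p| ≤ η := abs_integral_le hη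
  rw [integral_sub hV hV'] at h1
  have h2 := hη s
  rw [abs_le] at h1 h2 ⊢
  constructor <;> linarith [h1.1, h1.2, h2.1, h2.2]

/-- The error of the transition value estimation for `V`, in terms of the transition noise of a
nearby function `V'`. -/
lemma norm_sub_le_of_valueLoss_min [MeasurableSpace S] [MeasurableSpace A] (M : MDP S A) (hφ : ∀ x, ‖φ x‖ ≤ 1) {h : Fin H}
    (hlt : h.val + 1 < H) {V V' : S → ℝ} {w w' : EuclideanSpace ℝ (Fin d)}
    (hw : ∀ w', valueLoss φ 1 D h V w ≤ valueLoss φ 1 D h V w') (hm0 : 0 < m)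
    (hm : ∀ v : Fin H × Fin d → ℝ, m * (v ⬝ᵥ v) ≤ ∑ i, (trajFeature φ (D i).1 ⬝ᵥ v) ^ 2)
    (hV : ∀ x, Integrable V (M.P h x)) (hV' : ∀ x, Integrable V' (M.P h x))
    (hw' : ∀ x, ∫ s, V s ∂(M.P h x) = inner ℝ (φ x) w') {W : ℝ} (hW : ‖w'‖ ≤ W) {η : ℝ}
    (hη : ∀ s, |V s - V' s| ≤ η) {t : ℝ} (ht : 0 ≤ t)
    (hnoise : ∀ j, |∑ i, φ ((D i).1 h) j * (V' ((D i).1 ⟨h.val + 1, hlt⟩).1 -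
      ∫ s, V' s ∂(M.P h ((D i).1 h)))| ≤ t) :
    ‖w - w'‖ ≤ (√(d : ℝ) * t + N * (2 * η) + W) / m := by
  have h1 := ridge_error_le (x := fun i => φ ((D i).1 h))
    (y := fun i => nextValue V (D i).1 h) (w := w)
    (fun w' => by simpa only [valueLoss, one_mul] using hw w')
    (mul_norm_sq_le_sum_inner_feature hm h) w'
  set f : (S → ℝ) → Fin N → ℝ := fun V i => V ((D i).1 ⟨h.val + 1, hlt⟩).1 -
      ∫ s, V s ∂(M.P h ((D i).1 h)) with hf
  have h2 : ∑ i, (nextValue V (D i).1 h - inner ℝ (φ ((D i).1 h)) w') • φ ((D i).1 h) =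
      ∑ i, f V' i • φ ((D i).1 h) + ∑ i, (f V i - f V' i) • φ ((D i).1 h) := by
    rw [← Finset.sum_add_distrib]
    refine Finset.sum_congr rfl fun i _ => ?_
    rw [← add_smul, nextValue, dif_pos hlt, hf, ← hw']
    congr 1
    ring
  have h3 : ‖∑ i, f V' i • φ ((D i).1 h)‖ ≤ √(d : ℝ) * t := by
    refine norm_le_sqrt_card_mul ht fun j => ?_
    refine le_trans (le_of_eq ?_) (hnoise j)
    congr 1
    simp [hf, mul_comm]
  have h4 : ‖∑ i, (f V i - f V' i) • φ ((D i).1 h)‖ ≤ N * (2 * η) := by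
    refine (norm_sum_le _ _).trans ?_
    have := Finset.sum_le_card_nsmul Finset.univ
      (fun i => ‖(f V i - f V' i) • φ ((D i).1 h)‖) (2 * η) fun i _ => by
        rw [norm_smul]
        refine (mul_le_of_le_one_right (norm_nonneg _) (hφ _)).trans ?_
        exact abs_sub_integral_sub_le (hV _) (hV' _) hη _
    simpa using this
  rw [le_div_iff₀ hm0, mul_comm]
  refine h1.trans ?_
  rw [h2]
  linarith [norm_add_le (∑ i, f V' i • φ ((D i).1 h)) (∑ i, (f V i - f V' i) • φ ((D i).1 h))]

/-- After the last step there is nothing to estimate. -/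
lemma eq_zero_of_valueLoss_min {h : Fin H} (hlt : ¬ h.val + 1 < H) {V : S → ℝ}
    {w : EuclideanSpace ℝ (Fin d)}
    (hw : ∀ w', valueLoss φ 1 D h V w ≤ valueLoss φ 1 D h V w') : w = 0 := by
  have h1 := ridge_norm_sq_le (x := fun i => φ ((D i).1 h)) (y := fun i => nextValue V (D i).1 h)
    (w := w) (fun w' => by simpa only [valueLoss, one_mul] using hw w')
  simpa [nextValue, hlt] using h1

end Regression

/-! ### Sub-optimality on regular data -/

section Regular

variable {S A : Type*} [MeasurableSpace S] [MeasurableSpace A] {d H N : ℕ}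

/-- The deviation of an entry of `Φ(τ) Φ(τ)ᵀ` from its mean under the law `ρ`. -/
noncomputable def momentNoise (φ : S × A → EuclideanSpace ℝ (Fin d))
    (ρ : Measure (Episode S A H)) (p : (Fin H × Fin d) × (Fin H × Fin d))
    (e : Episode S A H) : ℝ :=
  trajFeature φ e.1 p.1 * trajFeature φ e.1 p.2 - trajMoment φ ρ p.1 p.2

/-- A coordinate of `Φ(τ) (r(τ) - ∑_h R_h(x_h))`. The return is truncated to `[0, H]`, where it lies
almost surely, in order to have a bounded function. -/
noncomputable def returnNoise (M : MDP S A) (φ : S × A → EuclideanSpace ℝ (Fin d))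
    (p : Fin H × Fin d) (e : Episode S A H) : ℝ :=
  trajFeature φ e.1 p * (clip H e.2 - ∑ h : Fin H, M.meanReward h (e.1 h))

/-- A coordinate of `φ(x_h) (V(s_{h+1}) - P_h V(x_h))`, for the greedy value `V` at step `h + 1` of
a point of the grid; `0` for the last step. -/
noncomputable def transitionNoise (M : MDP S A) (φ : S × A → EuclideanSpace ℝ (Fin d)) (γ : ℝ)
    (n : ℕ) (q : Fin H × Fin d × (Fin d → Fin (2 * n + 1))) (e : Episode S A H) : ℝ :=
  if hlt : q.1.val + 1 < H then
    φ (e.1 q.1) q.2.1 *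
      (greedyValue φ ((H : ℝ) - (q.1.val + 1 : ℕ)) (netPoint γ n q.2.2) (e.1 ⟨q.1.val + 1, hlt⟩).1 -
        ∫ s, greedyValue φ ((H : ℝ) - (q.1.val + 1 : ℕ)) (netPoint γ n q.2.2) s
          ∂(M.P q.1 (e.1 q.1)))
  else 0

/-- The data sets on which the algorithm works: all the noise terms have small sums. -/
structure IsRegularData (M : MDP S A) (φ : S × A → EuclideanSpace ℝ (Fin d))
    (ρ : Measure (Episode S A H)) (γ : ℝ) (n : ℕ) (t₁ t₂ t₃ : ℝ)
    (D : Fin N → Episode S A H) : Prop where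
  ret_mem : ∀ i, (D i).2 ∈ Set.Icc (0 : ℝ) H
  moment : ∀ p, |∑ i, momentNoise φ ρ p (D i)| ≤ t₁
  ret : ∀ p, |∑ i, returnNoise M φ p (D i)| ≤ t₂
  transition : ∀ q, |∑ i, transitionNoise M φ γ n q (D i)| ≤ t₃

variable [Fintype A] [MeasurableSingletonClass A]

/-- On regular data, every output of the algorithm has small sub-optimality: the three summands of
the error per step come from the reward redistribution, from the transition value estimation and
from the penalties. -/
lemma IsRegularData.subOpt_le {M : MDP S A} {Z : Set S} {φ : S × A → EuclideanSpace ℝ (Fin d)}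
    (hM : IsLinearMDP M H Z φ) {ρ : Measure (Episode S A H)} {c : ℝ}
    (hc : MinEigenvalueGE (trajMoment φ ρ) c) {γ : ℝ} {n : ℕ} {t₁ t₂ t₃ : ℝ}
    {D : Fin N → Episode S A H} (hD : IsRegularData M φ ρ γ n t₁ t₂ t₃ D) {m : ℝ} (hm0 : 0 < m)
    (hmN : m ≤ N * c - t₁ * (H * d)) (ht₂ : 0 ≤ t₂) (ht₃ : 0 ≤ t₃) (hγ : 0 < γ)
    (hγn : 2 * H * √(N : ℝ) ≤ γ * n) {β₁ β₂ : ℝ} (hβ₁ : 0 ≤ β₁) (hβ₂ : 0 ≤ β₂)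
    {πhat : Policy S A} (hout : IsOutput φ 1 1 β₁ β₂ D πhat) (s : S) :
    subOpt M H πhat s ≤ 2 * H * (√((H : ℝ) * d) * (t₂ + 1) / m +
      (√(d : ℝ) * t₃ + N * (2 * ((β₁ + β₂) * √(1 / m) + √(d : ℝ) * γ)) + H * √(d : ℝ)) / m +
      (β₁ + β₂) * √(1 / m)) := by
  obtain ⟨θ, hθ, hR, hlin⟩ := hM.exists_params
  obtain ⟨-, hφm, hφ1, hφZ, -⟩ := hM
  obtain ⟨Θ, w, Q, V, hΘ, hlast, hstep⟩ := hout
  have hw := fun h => (hstep h).1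
  have hQ := fun h => (hstep h).2.1
  have hgreedy := fun h => (hstep h).2.2.1
  have hV := fun h => (hstep h).2.2.2
  have hH : ∀ h : Fin H, (0 : ℝ) ≤ (H : ℝ) - (h : ℕ) := fun h =>
    sub_nonneg.2 (Nat.cast_le.2 h.2.le)
  -- the empirical second moment
  have hm : ∀ v : Fin H × Fin d → ℝ,
      m * (v ⬝ᵥ v) ≤ ∑ i, (trajFeature φ (D i).1 ⬝ᵥ v) ^ 2 := by
    intro v
    have h1 := le_sum_sq_dotProduct (x := fun i => trajFeature φ (D i).1) hc.le_dotProduct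
      (fun p q => hD.moment (p, q)) v
    have h2 : 0 ≤ v ⬝ᵥ v := dotProduct_self_star_nonneg _
    refine le_trans (mul_le_mul_of_nonneg_right ?_ h2) h1
    simpa using hmN
  -- the penalties
  set pen : ℝ := (β₁ + β₂) * √(1 / m) with hpen
  have hΓ : ∀ h x, |β₁ * rewardPenalty φ 1 D h x + β₂ * valuePenalty φ 1 D h x| ≤ pen := by
    intro h x
    have h1 := rewardPenalty_le hφ1 hm0 hm h x
    have h2 := valuePenalty_le hφ1 hm0 hm h x
    have h3 : 0 ≤ rewardPenalty φ 1 D h x := Real.sqrt_nonneg _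
    have h4 : 0 ≤ valuePenalty φ 1 D h x := Real.sqrt_nonneg _
    rw [abs_of_nonneg (by positivity), hpen, add_mul]
    exact add_le_add (mul_le_mul_of_nonneg_left h1 hβ₁) (mul_le_mul_of_nonneg_left h2 hβ₂)
  have hpen0 : 0 ≤ pen := by positivity
  -- the estimated values
  have hQclip : ∀ h x, Q h x = clip ((H : ℝ) - (h : ℕ)) (inner ℝ (φ x) (Θ h + w h) -
      (β₁ * rewardPenalty φ 1 D h x + β₂ * valuePenalty φ 1 D h x)) := fun h x => by
    rw [hQ, inner_add_right]; rfl
  have hQm : ∀ h, Measurable (Q h) := by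
    intro h
    have h1 := measurable_rewardPenalty hφm 1 D h
    have h2 := measurable_valuePenalty hφm 1 D h
    rw [funext (hQclip h)]
    exact (measurable_clip _).comp ((hφm.inner measurable_const).sub
      ((h1.const_mul _).add (h2.const_mul _)))
  have hVm : ∀ h : Fin (H + 1), Measurable (V h) := by
    intro h
    induction h using Fin.lastCases with
    | last => rw [funext hlast]; exact measurable_const
    | cast h => rw [funext (hV h)]; exact measurable_policyAvg πhat h (hQm h)
  have hVmem : ∀ (h : Fin (H + 1)) s, V h s ∈ Set.Icc (0 : ℝ) ((H : ℝ) - (h : ℕ)) := by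
    intro h s
    induction h using Fin.lastCases with
    | last => simp [hlast]
    | cast h =>
      rw [hV h]
      refine policyAvg_mem_Icc πhat h s fun a => ?_
      rw [hQclip]
      exact ⟨clip_nonneg _ _, clip_le (hH h) _⟩
  have hVH : ∀ (h : Fin (H + 1)) s, |V h s| ≤ H := by
    intro h s
    rw [abs_of_nonneg (hVmem h s).1]
    exact (hVmem h s).2.trans (sub_le_self _ (Nat.cast_nonneg _))
  have hVi : ∀ h : Fin (H + 1), ∀ p : Measure S, IsProbabilityMeasure p → Integrable (V h) p :=
    fun h p _ => integrable_of_abs_le (hVm h) (hVH h)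
  have hVZ : ∀ (h : Fin (H + 1)), ∀ s ∈ Z, V h s = 0 := by
    intro h s hs
    induction h using Fin.lastCases with
    | last => exact hlast s
    | cast h =>
      rw [hV h]
      refine Finset.sum_eq_zero fun a _ => ?_
      have h0 : oneBlockHot φ h (s, a) = 0 := by
        ext p; simp [oneBlockHot, hφZ s hs a]
      show _ * Q h (s, a) = 0
      rw [hQclip]
      simp [hφZ s hs a, rewardPenalty, valuePenalty, h0, clip, hH h]
  -- the two regressions
  have hΘerr : ∀ h, ‖Θ h - θ h‖ ≤ √((H : ℝ) * d) * (t₂ + 1) / m := by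
    refine norm_sub_le_of_rewardLoss_min hΘ hm0 hm hθ ht₂ fun p => ?_
    refine le_trans (le_of_eq ?_) (hD.ret p)
    congr 1
    refine Finset.sum_congr rfl fun i _ => ?_
    rw [returnNoise, clip_of_mem (hD.ret_mem i)]
    simp only [hR]
  have hu : ∀ h, ‖Θ h + w h‖ ≤ γ * n := by
    intro h
    have h1 := norm_le_of_rewardLoss_min hΘ (Nat.cast_nonneg H) (fun i => by
      rw [abs_of_nonneg (hD.ret_mem i).1]; exact (hD.ret_mem i).2) h
    have h2 := norm_le_of_valueLoss_min (hw h) (Nat.cast_nonneg H) (hVH _)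
    linarith [norm_add_le (Θ h) (w h)]
  have hwerr : ∀ h : Fin H, ∃ w' : EuclideanSpace ℝ (Fin d),
      (∀ x, ∫ s, V h.succ s ∂(M.P h x) = inner ℝ (φ x) w') ∧ ‖w h - w'‖ ≤
        (√(d : ℝ) * t₃ + N * (2 * (pen + √(d : ℝ) * γ)) + H * √(d : ℝ)) / m := by
    intro h
    by_cases hlt : h.val + 1 < H
    · obtain ⟨w', hw', hPV⟩ := hlin h (V h.succ) H (hVm _) (Nat.cast_nonneg H) (hVH _) (hVZ _)
      refine ⟨w', hPV, ?_⟩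
      -- `V_{h+1}` is, up to the penalties, the greedy value of a linear score
      set h' : Fin H := ⟨h.val + 1, hlt⟩ with hh'
      obtain ⟨k, hk⟩ := exists_norm_sub_netPoint_le hγ (hu h')
      have hsucc : h.succ = h'.castSucc := by ext; simp [hh']
      have hclose : ∀ s, |V h.succ s -
          greedyValue φ ((H : ℝ) - (h.val + 1 : ℕ)) (netPoint γ n k) s| ≤
            pen + √(d : ℝ) * γ := by
        intro s
        have h1 : |V h.succ s - greedyValue φ ((H : ℝ) - (h' : ℕ)) (Θ h' + w h') s| ≤ pen := by
          rw [hsucc, hV h']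
          refine abs_policyAvg_sub_ciSup_le πhat h' s (fun a => ?_) (hgreedy h' s)
          rw [hQclip]
          refine (abs_clip_sub_le _ _ _).trans ?_
          rw [sub_sub_cancel_left, abs_neg]
          exact hΓ h' (s, a)
        have h2 := abs_greedyValue_sub_le hφ1 ((H : ℝ) - (h' : ℕ)) (Θ h' + w h')
          (netPoint γ n k) s
        exact (abs_sub_le _ _ _).trans (add_le_add h1 (h2.trans hk))
      refine norm_sub_le_of_valueLoss_min M hφ1 hlt (hw h) hm0 hm
        (fun x => hVi _ _ inferInstance) (fun x => ?_) hPV hw' hclose ht₃ fun j => ?_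
      · exact integrable_of_abs_le (measurable_greedyValue hφm _ _) fun s =>
          abs_greedyValue_le (hH h') _ s
      · refine le_trans (le_of_eq ?_) (hD.transition (h, j, k))
        congr 1
        refine Finset.sum_congr rfl fun i _ => ?_
        rw [transitionNoise, dif_pos hlt]
    · have hsucc : h.succ = Fin.last H := by ext; simp; omega
      refine ⟨0, fun x => by simp [hsucc, hlast], ?_⟩
      rw [eq_zero_of_valueLoss_min hlt (hw h), sub_zero, norm_zero]
      positivity
  -- the error per step
  refine subOpt_le_of_abs_backup_le M πhat hlast hVi (fun h x => ?_) hgreedy hV s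
  obtain ⟨w', hPV, hwe⟩ := hwerr h
  have hback : M.meanReward h x + ∫ s', V h.succ s' ∂(M.P h x) ∈
      Set.Icc (0 : ℝ) ((H : ℝ) - (h : ℕ)) := by
    have h1 := meanReward_mem M h x
    have h2 : 0 ≤ ∫ s', V h.succ s' ∂(M.P h x) := integral_nonneg fun s => (hVmem _ s).1
    have h3 : |∫ s', V h.succ s' ∂(M.P h x)| ≤ (H : ℝ) - (h.succ : ℕ) :=
      abs_integral_le fun s => by rw [abs_of_nonneg (hVmem _ s).1]; exact (hVmem _ s).2
    have h4 := (abs_le.1 h3).2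
    simp only [Fin.val_succ] at h4
    push_cast at h4
    exact ⟨by linarith [h1.1], by linarith [h1.2]⟩
  rw [← clip_of_mem hback, hQclip]
  refine (abs_clip_sub_le _ _ _).trans ?_
  rw [hR, hPV]
  have h1 : inner ℝ (φ x) (θ h) + inner ℝ (φ x) w' - (inner ℝ (φ x) (Θ h + w h) -
      (β₁ * rewardPenalty φ 1 D h x + β₂ * valuePenalty φ 1 D h x)) =
      -inner ℝ (φ x) (Θ h - θ h) + -inner ℝ (φ x) (w h - w') +
      (β₁ * rewardPenalty φ 1 D h x + β₂ * valuePenalty φ 1 D h x) := by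
    simp only [inner_add_right, inner_sub_right]; ring
  rw [h1]
  have h2 : ∀ v : EuclideanSpace ℝ (Fin d), |-inner ℝ (φ x) v| ≤ ‖v‖ := fun v => by
    rw [abs_neg]
    exact (abs_real_inner_le_norm _ _).trans (mul_le_of_le_one_left (norm_nonneg _) (hφ1 x))
  refine (abs_add_le _ _).trans (add_le_add ((abs_add_le _ _).trans (add_le_add ?_ ?_)) (hΓ h x))
  · exact (h2 _).trans (hΘerr h)
  · exact (h2 _).trans hwe

end Regular

/-! ### Regular data have high probability -/

section Noise

variable {S A : Type*} {d H N : ℕ} {φ : S × A → EuclideanSpace ℝ (Fin d)}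

lemma abs_trajFeature_le (hφ : ∀ x, ‖φ x‖ ≤ 1) (τ : Fin H → S × A) (p : Fin H × Fin d) :
    |trajFeature φ τ p| ≤ 1 :=
  (PiLp.norm_apply_le (φ (τ p.1)) p.2).trans (hφ _)

lemma abs_trajFeature_mul_le (hφ : ∀ x, ‖φ x‖ ≤ 1) (τ : Fin H → S × A) (p q : Fin H × Fin d) :
    |trajFeature φ τ p * trajFeature φ τ q| ≤ 1 := by
  rw [abs_mul]
  exact mul_le_one₀ (abs_trajFeature_le hφ τ p) (abs_nonneg _) (abs_trajFeature_le hφ τ q)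

variable [MeasurableSpace S] [MeasurableSpace A]

lemma measurable_trajFeature (hφ : Measurable φ) (p : Fin H × Fin d) :
    Measurable fun τ : Fin H → S × A => trajFeature φ τ p := by
  unfold trajFeature
  fun_prop

lemma measurable_trajFeature_mul (hφ : Measurable φ) (p q : Fin H × Fin d) :
    Measurable fun e : Episode S A H => trajFeature φ e.1 p * trajFeature φ e.1 q :=
  ((measurable_trajFeature hφ p).comp measurable_fst).mul
    ((measurable_trajFeature hφ q).comp measurable_fst)

variable {ρ : Measure (Episode S A H)}

lemma measurable_momentNoise (hφ : Measurable φ) (p : (Fin H × Fin d) × (Fin H × Fin d)) :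
    Measurable (momentNoise φ ρ p) :=
  (measurable_trajFeature_mul hφ p.1 p.2).sub_const _

lemma abs_momentNoise_le [IsProbabilityMeasure ρ] (hφ : ∀ x, ‖φ x‖ ≤ 1)
    (p : (Fin H × Fin d) × (Fin H × Fin d)) (e : Episode S A H) : |momentNoise φ ρ p e| ≤ 2 := by
  have h1 := abs_trajFeature_mul_le hφ e.1 p.1 p.2
  have h2 : |trajMoment φ ρ p.1 p.2| ≤ 1 :=
    abs_integral_le (ρ := ρ) fun e => abs_trajFeature_mul_le hφ e.1 p.1 p.2
  exact (abs_sub _ _).trans (by linarith)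

lemma integral_momentNoise [IsProbabilityMeasure ρ] (hφm : Measurable φ) (hφ : ∀ x, ‖φ x‖ ≤ 1)
    (p : (Fin H × Fin d) × (Fin H × Fin d)) : ∫ e, momentNoise φ ρ p e ∂ρ = 0 := by
  unfold momentNoise
  rw [integral_sub (integrable_of_abs_le (measurable_trajFeature_mul hφm p.1 p.2)
    fun e => abs_trajFeature_mul_le hφ e.1 p.1 p.2) (integrable_const _)]
  simp [trajMoment]

lemma measurable_returnNoise (M : MDP S A) (hφ : Measurable φ) (p : Fin H × Fin d) :
    Measurable (returnNoise M φ p) := by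
  have h1 := (measurable_trajFeature hφ p).comp
    (measurable_fst : Measurable (Prod.fst : Episode S A H → _))
  have h2 := measurable_meanReward M
  have h3 := measurable_clip H
  exact h1.mul (by fun_prop)

lemma abs_returnNoise_le (M : MDP S A) (hφ : ∀ x, ‖φ x‖ ≤ 1) (p : Fin H × Fin d)
    (e : Episode S A H) : |returnNoise M φ p e| ≤ H := by
  rw [returnNoise, abs_mul]
  refine (mul_le_of_le_one_left (abs_nonneg _) (abs_trajFeature_le hφ _ _)).trans ?_
  have h1 : 0 ≤ ∑ h : Fin H, M.meanReward h (e.1 h) :=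
    Finset.sum_nonneg fun i _ => (meanReward_mem M _ _).1
  have h2 : ∑ h : Fin H, M.meanReward h (e.1 h) ≤ H := by
    simpa using Finset.sum_le_card_nsmul Finset.univ _ 1 fun (i : Fin H) _ =>
      (meanReward_mem M i (e.1 i)).2
  have h3 := clip_nonneg H e.2
  have h4 := clip_le (Nat.cast_nonneg H) e.2
  exact abs_le.2 ⟨by linarith, by linarith⟩

lemma integral_returnNoise (M : MDP S A) (π : Policy S A) (ν₀ : Measure S)
    [IsProbabilityMeasure ν₀] (hφm : Measurable φ) (hφ : ∀ x, ‖φ x‖ ≤ 1) (p : Fin H × Fin d) :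
    ∫ e, returnNoise M φ p e ∂(episodeLaw M H π ν₀) = 0 :=
  integral_return_noise M H π ν₀ (measurable_trajFeature hφm p)
    fun τ => abs_trajFeature_le hφ τ p

variable [Finite A] (M : MDP S A) (γ : ℝ) (n : ℕ)

lemma measurable_transitionNoise (hφ : Measurable φ)
    (q : Fin H × Fin d × (Fin d → Fin (2 * n + 1))) :
    Measurable (transitionNoise M φ γ n q) := by
  unfold transitionNoise
  split_ifs with hlt
  · have hV := measurable_greedyValue hφ ((H : ℝ) - (q.1.val + 1 : ℕ)) (netPoint γ n q.2.2)
    have hP : Measurable fun x => ∫ s, greedyValue φ ((H : ℝ) - (q.1.val + 1 : ℕ))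
        (netPoint γ n q.2.2) s ∂(M.P q.1 x) :=
      (StronglyMeasurable.integral_kernel (κ := M.P q.1) hV.stronglyMeasurable).measurable
    have h1 : ∀ j : Fin H, Measurable fun e : Episode S A H => e.1 j := by fun_prop
    exact (measurable_trajFeature hφ (q.1, q.2.1)).comp measurable_fst |>.mul
      ((hV.comp (measurable_fst.comp (h1 _))).sub (hP.comp (h1 _)))
  · exact measurable_const

lemma abs_transitionNoise_le (hφ : ∀ x, ‖φ x‖ ≤ 1)
    (q : Fin H × Fin d × (Fin d → Fin (2 * n + 1))) (e : Episode S A H) :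
    |transitionNoise M φ γ n q e| ≤ 2 * H := by
  unfold transitionNoise
  split_ifs with hlt
  · rw [abs_mul]
    refine (mul_le_of_le_one_left (abs_nonneg _)
      (abs_trajFeature_le hφ e.1 (q.1, q.2.1))).trans ?_
    have hb : (0 : ℝ) ≤ (H : ℝ) - (q.1.val + 1 : ℕ) := sub_nonneg.2 (Nat.cast_le.2 hlt.le)
    have hb' : (H : ℝ) - (q.1.val + 1 : ℕ) ≤ H := sub_le_self _ (Nat.cast_nonneg _)
    have h1 := fun s => (abs_greedyValue_le (φ := φ) hb (netPoint γ n q.2.2) s).trans hb'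
    refine (abs_sub _ _).trans ?_
    linarith [h1 (e.1 ⟨q.1.val + 1, hlt⟩).1, abs_integral_le (ρ := M.P q.1 (e.1 q.1)) h1]
  · simp

lemma integral_transitionNoise (π : Policy S A) (ν₀ : Measure S) [IsProbabilityMeasure ν₀]
    (hφm : Measurable φ) (hφ : ∀ x, ‖φ x‖ ≤ 1)
    (q : Fin H × Fin d × (Fin d → Fin (2 * n + 1))) :
    ∫ e, transitionNoise M φ γ n q e ∂(episodeLaw M H π ν₀) = 0 := by
  unfold transitionNoise
  split_ifs with hlt
  · have hb : (0 : ℝ) ≤ (H : ℝ) - (q.1.val + 1 : ℕ) := sub_nonneg.2 (Nat.cast_le.2 hlt.le)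
    exact integral_episode_transition_noise M H π ν₀ (measurable_greedyValue hφm _ _)
      (abs_greedyValue_le hb _) (g := fun x => φ x q.2.1) (by fun_prop) (G := 1)
      (fun x => (PiLp.norm_apply_le (φ x) q.2.1).trans (hφ x)) q.1 hlt
  · simp

end Noise

section Probability

variable {S A Ω : Type*} [MeasurableSpace S] [MeasurableSpace A] [Finite A] [MeasurableSpace Ω]
  {Pr : Measure Ω} [IsProbabilityMeasure Pr] {d H N : ℕ} {φ : S × A → EuclideanSpace ℝ (Fin d)}

/-- Regular data have high probability, by Hoeffding's inequality for the finitely many noise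
terms. -/
lemma exists_isRegularData (M : MDP S A) (hφm : Measurable φ) (hφ : ∀ x, ‖φ x‖ ≤ 1)
    (π : Policy S A) (ν₀ : Measure S) [IsProbabilityMeasure ν₀]
    {D : Fin N → Ω → Episode S A H} (hD : ∀ i, Measurable (D i)) (hind : iIndepFun D Pr)
    (hlaw : ∀ i, Measure.map (D i) Pr = episodeLaw M H π ν₀) (γ : ℝ) (n : ℕ) {t₁ t₂ t₃ : ℝ}
    (ht₁ : 0 ≤ t₁) (ht₂ : 0 ≤ t₂) (ht₃ : 0 ≤ t₃) :
    ∃ E : Set Ω, MeasurableSet E ∧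
      Pr.real Eᶜ ≤ (H * d) ^ 2 * (2 * Real.exp (-t₁ ^ 2 / (2 * N * 2 ^ 2))) +
        H * d * (2 * Real.exp (-t₂ ^ 2 / (2 * N * (H : ℝ) ^ 2))) +
        H * d * (2 * n + 1) ^ d * (2 * Real.exp (-t₃ ^ 2 / (2 * N * (2 * H : ℝ) ^ 2))) ∧
      ∀ ω ∈ E, IsRegularData M φ (episodeLaw M H π ν₀) γ n t₁ t₂ t₃ (fun i => D i ω) := by
  set ρ := episodeLaw M H π ν₀ with hρ
  set B₀ := {ω | ∃ i, (D i ω).2 ∉ Set.Icc (0 : ℝ) H} with hB₀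
  set B₁ := {ω | ∃ p, t₁ < |∑ i, momentNoise φ ρ p (D i ω)|} with hB₁
  set B₂ := {ω | ∃ p, t₂ < |∑ i, returnNoise M φ p (D i ω)|} with hB₂
  set B₃ := {ω | ∃ q, t₃ < |∑ i, transitionNoise M φ γ n q (D i ω)|} with hB₃
  have h0m : MeasurableSet B₀ := by
    rw [hB₀, Set.ofPred_exists]
    exact MeasurableSet.iUnion fun i => (measurable_snd.comp (hD i)) measurableSet_Icc.compl
  have h0 : Pr.real B₀ = 0 := by
    refine (measureReal_eq_zero_iff (measure_ne_top _ _)).2 ?_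
    rw [hB₀, Set.ofPred_exists]
    refine measure_iUnion_null fun i => ?_
    have h1 := ae_return_mem M H π ν₀
    rw [← hρ, ← hlaw i] at h1
    exact ae_of_ae_map (hD i).aemeasurable h1
  have h1 := measureReal_exists_lt_abs_sum_le hD hind hlaw
    (fun p => measurable_momentNoise (ρ := ρ) hφm p) (abs_momentNoise_le hφ)
    (integral_momentNoise hφm hφ) ht₁
  have h2 := measureReal_exists_lt_abs_sum_le hD hind hlaw
    (measurable_returnNoise M hφm) (abs_returnNoise_le M hφ)
    (integral_returnNoise M π ν₀ hφm hφ) ht₂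
  have h3 := measureReal_exists_lt_abs_sum_le hD hind hlaw
    (measurable_transitionNoise M γ n hφm) (abs_transitionNoise_le M γ n hφ)
    (integral_transitionNoise M γ n π ν₀ hφm hφ) ht₃
  refine ⟨(B₀ ∪ B₁ ∪ B₂ ∪ B₃)ᶜ, ?_, ?_, ?_⟩
  · refine MeasurableSet.compl (((h0m.union ?_).union ?_).union ?_)
    · exact measurableSet_exists_lt_abs_sum hD (fun p => measurable_momentNoise hφm p) t₁
    · exact measurableSet_exists_lt_abs_sum hD (measurable_returnNoise M hφm) t₂
    · exact measurableSet_exists_lt_abs_sum hD (measurable_transitionNoise M γ n hφm) t₃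
  · rw [compl_compl]
    have h4 := measureReal_union_le (μ := Pr) (B₀ ∪ B₁ ∪ B₂) B₃
    have h5 := measureReal_union_le (μ := Pr) (B₀ ∪ B₁) B₂
    have h6 := measureReal_union_le (μ := Pr) B₀ B₁
    simp only [Fintype.card_prod, Fintype.card_fin, Fintype.card_pi, Finset.prod_const,
      Finset.card_univ] at h1 h2 h3
    push_cast at h1 h2 h3
    rw [← sq] at h1
    rw [← mul_assoc (H : ℝ)] at h3
    linarith
  · intro ω hω
    simp only [Set.compl_union, Set.mem_inter_iff, Set.mem_compl_iff, hB₀, hB₁, hB₂, hB₃,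
      Set.mem_ofPred_eq, not_exists, not_lt, not_not] at hω
    exact ⟨hω.1.1.1, hω.1.1.2, hω.1.2, hω.2⟩

end Probability

/-! ### Arithmetic of the bound -/

section Main

/-- The union bound, with `x` the reciprocal of the argument of the logarithm. -/
lemma union_bound_le {d : ℕ} (hd : 0 < d) {x δ k g : ℝ} (hx0 : 0 < x) (hxδ : x ≤ δ)
    (hx : x ≤ 1 / 4) (hk0 : 0 ≤ k) (hk : k * x ≤ 1) (hg0 : 0 ≤ g) (hg : g * x ^ 2 ≤ 1) :
    k ^ 2 * (2 * x ^ 8) + k * (2 * x ^ 8) + k * g ^ d * (2 * x ^ (8 * d)) ≤ δ := by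
  have hx1 : x ≤ 1 := by linarith
  have h3 : 6 * x ^ 3 ≤ δ := by nlinarith [sq_nonneg x, mul_pos hx0 hx0]
  have hkx : 0 ≤ k * x := by positivity
  have e1 : k ^ 2 * (2 * x ^ 8) ≤ 2 * x ^ 3 := by
    calc k ^ 2 * (2 * x ^ 8) = (k * x) ^ 2 * x ^ 3 * (2 * x ^ 3) := by ring
      _ ≤ 1 * 1 * (2 * x ^ 3) := by
        gcongr
        · exact pow_le_one₀ hkx hk
        · exact pow_le_one₀ hx0.le hx1
      _ = 2 * x ^ 3 := by ring
  have e2 : k * (2 * x ^ 8) ≤ 2 * x ^ 3 := by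
    calc k * (2 * x ^ 8) = (k * x) * x ^ 4 * (2 * x ^ 3) := by ring
      _ ≤ 1 * 1 * (2 * x ^ 3) := by
        gcongr
        exact pow_le_one₀ hx0.le hx1
      _ = 2 * x ^ 3 := by ring
  have e3 : k * g ^ d * (2 * x ^ (8 * d)) ≤ 2 * x ^ 3 := by
    have h1 : x ^ (8 * d) = x * (x ^ 2) ^ d * x ^ 3 * x ^ (6 * d - 4) := by
      rw [← pow_mul, ← pow_succ', ← pow_add, ← pow_add]
      congr 1
      omega
    calc k * g ^ d * (2 * x ^ (8 * d)) =
        (k * x) * (g * x ^ 2) ^ d * x ^ (6 * d - 4) * (2 * x ^ 3) := by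
          rw [h1, mul_pow]; ring
      _ ≤ 1 * 1 * 1 * (2 * x ^ 3) := by
        gcongr
        · exact pow_le_one₀ (by positivity) hg
        · exact pow_le_one₀ hx0.le hx1
      _ = 2 * x ^ 3 := by ring
  linarith

/-- The error of `IsRegularData.subOpt_le` is of the claimed order: here `q = √N`, `l = √L` with the
logarithm `L`, and `X = d H² √L / √N`. -/
lemma total_error_le {d H q l c P β X : ℝ} (hd : 1 ≤ d) (hH : 1 ≤ H) (hq : 1 ≤ q) (hl : 1 ≤ l)
    (hc : 0 < c) (hX : X * q = d * H ^ 2 * l) (hP : β * √(2 / c) ≤ P * (X * q)) :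
    √(H * d) * (4 * H * q * l + 1) / (c * q ^ 2 / 2) +
      (√d * (8 * H * q * l * √d) + q ^ 2 * (2 * (β * √(1 / (c * q ^ 2 / 2)) + √d * (1 / q))) +
        H * √d) / (c * q ^ 2 / 2) + β * √(1 / (c * q ^ 2 / 2)) ≤
      ((32 + 4 * P) / c + P) * X := by
  have hq0 : 0 < q := by linarith
  have hdH : 1 ≤ d * H := by nlinarith
  have hsd : √d ≤ d := by
    rw [Real.sqrt_le_left (by linarith)]; nlinarith
  have hsd1 : 1 ≤ √d := Real.one_le_sqrt.2 hd
  have hsHd : √(H * d) ≤ H * d := by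
    rw [Real.sqrt_le_left (by nlinarith)]; nlinarith
  have hsq : √d * √d = d := Real.mul_self_sqrt (by linarith)
  have hpen : β * √(1 / (c * q ^ 2 / 2)) ≤ P * X := by
    have h1 : √(1 / (c * q ^ 2 / 2)) = √(2 / c) / q := by
      rw [show 1 / (c * q ^ 2 / 2) = 2 / c / q ^ 2 by field_simp, Real.sqrt_div (by positivity),
        Real.sqrt_sq hq0.le]
    rw [h1, ← mul_div_assoc, div_le_iff₀ hq0]
    linarith
  set pen := β * √(1 / (c * q ^ 2 / 2)) with hpendef
  have hXpos : 0 < X := by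
    have : 0 < X * q := by rw [hX]; positivity
    exact pos_of_mul_pos_left this hq0.le
  have hdHX : d * H ^ 2 ≤ X * q := by rw [hX]; nlinarith [mul_pos (by linarith : 0 < d) (by positivity : 0 < H ^ 2)]
  have hXq : X * q ≤ X * q ^ 2 :=
    mul_le_mul_of_nonneg_left (le_self_pow₀ hq two_ne_zero) hXpos.le
  have hm : 0 < c * q ^ 2 / 2 := by positivity
  have t1 : √(H * d) * (4 * H * q * l + 1) ≤ 5 * (X * q ^ 2) := by
    have h1 : √(H * d) * (4 * H * q * l + 1) ≤ H * d * (4 * H * q * l + 1) := by gcongr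
    have h2 : H * d * (4 * H * q * l) = 4 * (X * q ^ 2) := by
      linear_combination (-4 * q) * hX
    have h3 : H * d ≤ d * H ^ 2 := by nlinarith
    nlinarith
  have t2 : √d * (8 * H * q * l * √d) ≤ 8 * (X * q ^ 2) := by
    have h1 : √d * (8 * H * q * l * √d) = 8 * (d * H * l) * q := by
      linear_combination (8 * H * q * l) * hsq
    have h2 : d * H * l ≤ X * q := by
      rw [hX]; nlinarith [mul_pos (mul_pos (by linarith : 0 < d) (by linarith : 0 < H)) (by linarith : 0 < l)]
    nlinarith
  have t3 : q ^ 2 * (2 * (pen + √d * (1 / q))) ≤ (2 * P + 2) * (X * q ^ 2) := by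
    have h1 : √d ≤ X * q := by nlinarith
    have h2 : √d * (1 / q) ≤ X := by
      rw [mul_one_div, div_le_iff₀ hq0]; exact h1
    have h3 : q ^ 2 * (2 * (pen + √d * (1 / q))) ≤ q ^ 2 * (2 * (P * X + X)) := by gcongr
    linarith
  have t4 : H * √d ≤ X * q ^ 2 := by nlinarith
  have key : ∀ {y k : ℝ}, y ≤ k * (X * q ^ 2) → y / (c * q ^ 2 / 2) ≤ 2 * k / c * X := by
    intro y k hy
    rw [div_le_iff₀ hm]
    refine hy.trans_eq ?_
    field_simp
  have s1 := key t1
  have s2 := key (y := √d * (8 * H * q * l * √d) + q ^ 2 * (2 * (pen + √d * (1 / q))) + H * √d)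
    (k := 11 + 2 * P) (by linarith)
  calc _ ≤ 2 * 5 / c * X + 2 * (11 + 2 * P) / c * X + P * X := add_le_add (add_le_add s1 s2) hpen
    _ = ((32 + 4 * P) / c + P) * X := by ring

end Main

/-! ### A single observation -/

section SingleObservation

lemma sqrt_dotProduct_mulVec_subsingleton {κ : Type*} [Fintype κ] [Subsingleton κ]
    (M : Matrix κ κ ℝ) (u : κ → ℝ) (p : κ) : √(u ⬝ᵥ M.mulVec u) = |u p| * √(M p p) := by
  have h : u ⬝ᵥ M.mulVec u = u p ^ 2 * M p p := by
    simp only [dotProduct, Matrix.mulVec, Fintype.sum_subsingleton _ p]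
    ring
  rw [h, Real.sqrt_mul (sq_nonneg _), Real.sqrt_sq_eq_abs]

lemma le_dotProduct_one_add_sum_vecMulVec {κ : Type*} [Fintype κ] [DecidableEq κ] {N : ℕ}
    (x : Fin N → κ → ℝ) (v : κ → ℝ) : 1 * (v ⬝ᵥ v) ≤
      v ⬝ᵥ ((1 : ℝ) • (1 : Matrix κ κ ℝ) + ∑ i, Matrix.vecMulVec (x i) (x i)).mulVec v := by
  rw [one_smul, Matrix.add_mulVec, Matrix.one_mulVec, dotProduct_add, dotProduct_sum_vecMulVec]
  have : 0 ≤ ∑ i, (x i ⬝ᵥ v) ^ 2 := Finset.sum_nonneg fun i _ => sq_nonneg _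
  linarith

lemma sqrt_inv_apply_le_one {κ : Type*} [Fintype κ] [DecidableEq κ] [Subsingleton κ]
    {M : Matrix κ κ ℝ} (hM : ∀ v, 1 * (v ⬝ᵥ v) ≤ v ⬝ᵥ M.mulVec v) (p : κ) :
    √(M⁻¹ p p) ≤ 1 := by
  refine Real.sqrt_le_one.2 ?_
  simpa [dotProduct, Matrix.mulVec, Fintype.sum_subsingleton _ p] using
    dotProduct_inv_mulVec_le one_pos hM 1

lemma inner_fin_one (u v : EuclideanSpace ℝ (Fin 1)) : inner ℝ u v = u 0 * v 0 := by
  rw [inner_eq_dotProduct]; simp [dotProduct]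

variable {S A : Type*} [MeasurableSpace S] [MeasurableSpace A]

/-- Markov's inequality from below, for a function with values in `[0, 1]`. -/
lemma integral_sub_le_measureReal_lt {Ω : Type*} [MeasurableSpace Ω] {Pr : Measure Ω}
    [IsProbabilityMeasure Pr] {f : Ω → ℝ} (hf : Measurable f) (hf0 : ∀ ω, 0 ≤ f ω)
    (hf1 : ∀ ω, f ω ≤ 1) {t : ℝ} (ht : 0 ≤ t) : ∫ ω, f ω ∂Pr - t ≤ Pr.real {ω | t < f ω} := by
  have hm : MeasurableSet {ω | t < f ω} := measurableSet_lt measurable_const hf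
  have hi : Integrable ({ω | t < f ω}.indicator (1 : Ω → ℝ)) Pr :=
    (integrable_const (1 : ℝ)).indicator hm
  have h1 : ∫ ω, f ω ∂Pr ≤ ∫ ω, ({ω | t < f ω}.indicator (1 : Ω → ℝ) ω + t) ∂Pr := by
    refine integral_mono (integrable_of_abs_le (B := 1) hf fun ω => ?_)
      (hi.add (integrable_const t)) fun ω => ?_
    · rw [abs_of_nonneg (hf0 ω)]; exact hf1 ω
    · by_cases hω : t < f ω
      · simp only [Set.indicator, Set.mem_ofPred_eq, hω, if_true, Pi.one_apply]
        linarith [hf1 ω]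
      · simp only [Set.indicator, Set.mem_ofPred_eq, hω, if_false]
        linarith [not_lt.1 hω]
  rw [integral_add hi (integrable_const t), integral_indicator_one hm] at h1
  simp at h1
  linarith

variable [Fintype A] [MeasurableSingletonClass A] {φ : S × A → EuclideanSpace ℝ (Fin 1)}

lemma expReturn_one (M : MDP S A) (π : Policy S A) (s : S) :
    expReturn M π 1 0 s = policyAvg π 0 s fun a => M.meanReward 0 (s, a) := by
  rw [expReturn_succ_eq_policyAvg]
  simp [expReturn_zero]

/-- With a single one-dimensional feature and a single step, the output is exactly optimal as soon
as the observed reward is large compared with the penalties: all estimates are then proportional to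
the mean reward. -/
lemma subOpt_nonpos_of_lt {M : MDP S A} {Z : Set S} (hM : IsLinearMDP M 1 Z φ)
    {D : Fin 1 → Episode S A 1} (hr : (D 0).2 ∈ Set.Icc (0 : ℝ) 1) {β₁ β₂ : ℝ}
    (hβ₁ : 0 ≤ β₁) (hβ₂ : 0 ≤ β₂) (hlarge : 2 * (β₁ + β₂) < (D 0).2 * |φ ((D 0).1 0) 0|)
    {πhat : Policy S A} (hout : IsOutput φ 1 1 β₁ β₂ D πhat)
    {ϑ : ℝ} (hϑ : ϑ ≠ 0) (hR : ∀ x, M.meanReward 0 x = φ x 0 * ϑ) (s : S) :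
    subOpt M 1 πhat s ≤ 0 := by
  obtain ⟨-, -, hφ1, -, -⟩ := hM
  obtain ⟨Θ, w, Q, V, hΘ, hlast, hstep⟩ := hout
  obtain ⟨hw, hQ, hgreedy, -⟩ := hstep 0
  have hw0 := eq_zero_of_valueLoss_min (by simp) hw
  have hz1 : ∀ x, |φ x 0| ≤ 1 := fun x => (PiLp.norm_apply_le (φ x) 0).trans (hφ1 x)
  set z := φ ((D 0).1 0) 0 with hz
  set r := (D 0).2 with hrdef
  -- the normal equation in dimension one
  have hnormal : Θ 0 0 * (1 + z ^ 2) = r * z := by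
    have h1 := ridge_normal_eq (x := fun i => φ ((D i).1 0)) (y := fun i => (D i).2) (w := Θ 0)
      (fun w' => by
        have := hΘ fun _ => w'
        simp only [rewardLoss, Finset.univ_unique, Finset.sum_singleton, one_mul] at this ⊢
        rw [← neg_sq, neg_sub, ← neg_sq (_ - inner ℝ _ w'), neg_sub]
        exact this) (WithLp.toLp 2 fun _ => 1)
    simp only [Finset.univ_unique, Finset.sum_singleton, inner_fin_one] at h1
    simp only [Fin.default_eq_zero, Fin.isValue, ← hz, ← hrdef] at h1
    linarith
  have hpos : 0 < 1 + z ^ 2 := by positivity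
  have hRpos : ∀ x, 0 ≤ φ x 0 * ϑ := fun x => hR x ▸ (meanReward_mem M 0 x).1
  have hsign : ∀ x, 0 ≤ φ x 0 * Θ 0 0 := by
    intro x
    have h1 : 0 ≤ φ x 0 * Θ 0 0 * ((1 + z ^ 2) * ϑ ^ 2) := by
      have : φ x 0 * Θ 0 0 * ((1 + z ^ 2) * ϑ ^ 2) = r * ((φ x 0 * ϑ) * (z * ϑ)) := by
        linear_combination (φ x 0 * ϑ ^ 2) * hnormal
      rw [this]
      exact mul_nonneg hr.1 (mul_nonneg (hRpos x) (hRpos _))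
    exact nonneg_of_mul_nonneg_left h1 (by positivity)
  have hz2 : z ^ 2 ≤ 1 := (sq_le_one_iff_abs_le_one z).2 (hz1 _)
  have habs : |Θ 0 0| * (1 + z ^ 2) = r * |z| := by
    rw [← abs_of_pos hpos, ← abs_mul, hnormal, abs_mul, abs_of_nonneg hr.1]
  have hΘ1 : |Θ 0 0| ≤ 1 := by
    have : r * |z| ≤ 1 := mul_le_one₀ hr.2 (abs_nonneg _) (hz1 _)
    nlinarith [abs_nonneg (Θ 0 0), sq_nonneg z]
  set k₁ := √((trajCov φ 1 D)⁻¹ (0, 0) (0, 0)) with hk₁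
  set k₂ := √((stepCov φ 1 D 0)⁻¹ 0 0) with hk₂
  have hk₁1 : k₁ ≤ 1 :=
    sqrt_inv_apply_le_one (fun v => le_dotProduct_one_add_sum_vecMulVec _ v) _
  have hk₂1 : k₂ ≤ 1 :=
    sqrt_inv_apply_le_one (fun v => le_dotProduct_one_add_sum_vecMulVec _ v) _
  have hb₁ : ∀ x, rewardPenalty φ 1 D 0 x = |φ x 0| * k₁ := fun x => by
    rw [rewardPenalty, sqrt_dotProduct_mulVec_subsingleton _ _ (0, 0)]; rfl
  have hb₂ : ∀ x, valuePenalty φ 1 D 0 x = |φ x 0| * k₂ := fun x => by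
    rw [valuePenalty, sqrt_dotProduct_mulVec_subsingleton _ _ 0]
  -- the slope of the estimated value
  set κ := |Θ 0 0| - (β₁ * k₁ + β₂ * k₂) with hκ
  have hκpos : 0 < κ := by
    have h1 : β₁ * k₁ ≤ β₁ := mul_le_of_le_one_right hβ₁ hk₁1
    have h2 : β₂ * k₂ ≤ β₂ := mul_le_of_le_one_right hβ₂ hk₂1
    have h3 : r * |z| ≤ 2 * |Θ 0 0| := by
      rw [← habs]; nlinarith [abs_nonneg (Θ 0 0)]
    linarith
  have hκ1 : κ ≤ 1 := by
    have h1 : 0 ≤ β₁ * k₁ := mul_nonneg hβ₁ (Real.sqrt_nonneg _)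
    have h2 : 0 ≤ β₂ * k₂ := mul_nonneg hβ₂ (Real.sqrt_nonneg _)
    linarith
  have hQ' : ∀ x, Q 0 x = κ / |ϑ| * M.meanReward 0 x := by
    intro x
    have h1 : inner ℝ (φ x) (Θ 0) + inner ℝ (φ x) (w 0) -
        (β₁ * rewardPenalty φ 1 D 0 x + β₂ * valuePenalty φ 1 D 0 x) = |φ x 0| * κ := by
      rw [hw0, inner_zero_right, inner_fin_one, hb₁, hb₂, ← abs_of_nonneg (hsign x), abs_mul]
      ring
    have h2 : |φ x 0| * κ ∈ Set.Icc (0 : ℝ) 1 :=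
      ⟨by positivity, mul_le_one₀ (hz1 x) hκpos.le hκ1⟩
    have h3 : M.meanReward 0 x = |φ x 0| * |ϑ| := by
      rw [hR, ← abs_of_nonneg (hRpos x), abs_mul]
    have h4 : (((1 : ℕ) : ℝ) - ((0 : Fin 1) : ℕ)) = 1 := by simp
    rw [hQ, h1, h4, h3, ← clip, clip_of_mem h2]
    have : |ϑ| ≠ 0 := abs_ne_zero.2 hϑ
    field_simp
  refine subOpt_le_of_forall M 1 πhat s fun π => ?_
  rw [expReturn_one, expReturn_one, add_zero]
  have h1 := hgreedy s _ (act_mem_stdSimplex π 0 s)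
  have h2 : ∀ π : Policy S A, policyAvg π 0 s (fun a => Q 0 (s, a)) =
      κ / |ϑ| * policyAvg π 0 s fun a => M.meanReward 0 (s, a) := by
    intro π
    simp only [policyAvg, hQ', Finset.mul_sum]
    exact Finset.sum_congr rfl fun a _ => by ring
  have h3 : policyAvg π 0 s (fun a => Q 0 (s, a)) ≤
      policyAvg πhat 0 s (fun a => Q 0 (s, a)) := h1
  rw [h2, h2] at h3
  exact le_of_mul_le_mul_left h3 (div_pos hκpos (abs_pos.2 hϑ))

variable {Ω : Type*} [MeasurableSpace Ω] {Pr : Measure Ω} [IsProbabilityMeasure Pr]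

/-- The case of a single observation, a single step and dimension one, in which no concentration
takes place: if the parameter is small, all policies are good, and if it is large, so is the
probability of observing a large reward. -/
lemma exists_event_single {M : MDP S A} {Z : Set S} (hM : IsLinearMDP M 1 Z φ) (π : Policy S A)
    (ν₀ : Measure S) [IsProbabilityMeasure ν₀] {c : ℝ}
    (hc : MinEigenvalueGE (trajMoment φ (episodeLaw M 1 π ν₀)) c)
    {D : Fin 1 → Ω → Episode S A 1} (hD : ∀ i, Measurable (D i))
    (hlaw : ∀ i, Measure.map (D i) Pr = episodeLaw M 1 π ν₀) {β₁ β₂ : ℝ}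
    (hβ₁ : 0 ≤ β₁) (hβ₂ : 0 ≤ β₂) (hc0 : 0 ≤ c) {η p : ℝ} (hη : 0 ≤ η) (hp : p ≤ 1)
    (hpη : p ≤ c * η - 2 * (β₁ + β₂)) :
    ∃ E : Set Ω, MeasurableSet E ∧ p ≤ Pr.real E ∧ ∀ ω ∈ E, ∀ πhat : Policy S A,
      IsOutput φ 1 1 β₁ β₂ (fun i => D i ω) πhat → ∀ s, subOpt M 1 πhat s ≤ η := by
  obtain ⟨θ, -, hRθ, -⟩ := hM.exists_params
  obtain ⟨-, hφm, hφ1, -, -⟩ := id hM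
  set ϑ := θ 0 0 with hϑdef
  have hR : ∀ x, M.meanReward 0 x = φ x 0 * ϑ := fun x => by
    have := hRθ 0 x
    rwa [inner_fin_one] at this
  have hz1 : ∀ x, |φ x 0| ≤ 1 := fun x => (PiLp.norm_apply_le (φ x) 0).trans (hφ1 x)
  have hR' : ∀ x, M.meanReward 0 x = |φ x 0| * |ϑ| := fun x => by
    rw [← abs_mul, ← hR, abs_of_nonneg (meanReward_mem M 0 x).1]
  by_cases hϑη : |ϑ| ≤ η
  · refine ⟨Set.univ, MeasurableSet.univ, by simpa using hp, fun ω _ πhat _ s => ?_⟩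
    refine subOpt_le_of_forall M 1 πhat s fun π' => ?_
    rw [expReturn_one]
    refine (policyAvg_mono π' 0 s (q' := fun _ => 0 + η) fun a => ?_).trans ?_
    · rw [hR', zero_add]
      exact (mul_le_of_le_one_left (abs_nonneg _) (hz1 _)).trans hϑη
    · rw [policyAvg_add_const]
      have : policyAvg π' 0 s (fun _ => 0) = 0 := by simp [policyAvg]
      rw [this]
      linarith [(expReturn_mem M πhat 1 0 s).1]
  · rw [not_le] at hϑη
    have hϑ0 : ϑ ≠ 0 := abs_pos.1 (hη.trans_lt hϑη)
    set g : Episode S A 1 → ℝ := fun e => |φ (e.1 0) 0| * clip 1 e.2 with hg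
    have hgm : Measurable g := by
      have h1 := measurable_clip 1
      have h2 : Measurable fun e : Episode S A 1 => φ (e.1 0) 0 :=
        (measurable_trajFeature hφm ((0 : Fin 1), (0 : Fin 1))).comp measurable_fst
      exact h2.abs.mul (by fun_prop)
    have hg0 : ∀ e, 0 ≤ g e := fun e => mul_nonneg (abs_nonneg _) (clip_nonneg _ _)
    have hg1 : ∀ e, g e ≤ 1 := fun e =>
      mul_le_one₀ (hz1 _) (clip_nonneg _ _) (clip_le zero_le_one _)
    -- the mean of the observed `|φ| r` is `E[φ²] |ϑ|`
    have hmean : c * |ϑ| ≤ ∫ e, g e ∂(episodeLaw M 1 π ν₀) := by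
      have hτ : Measurable fun τ : Fin 1 → S × A => |φ (τ 0) 0| :=
        (measurable_trajFeature hφm ((0 : Fin 1), (0 : Fin 1))).abs
      have h1 := integral_return_noise M 1 π ν₀ hτ (G := 1) fun τ => by simpa using hz1 (τ 0)
      have h2 : ∀ e : Episode S A 1, |φ (e.1 0) 0| * (clip ((1 : ℕ) : ℝ) e.2 -
          ∑ h : Fin 1, M.meanReward h (e.1 h)) = g e - φ (e.1 0) 0 * φ (e.1 0) 0 * |ϑ| := by
        intro e
        simp only [Finset.univ_unique, Finset.sum_singleton, Fin.default_eq_zero, Fin.val_zero,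
          hR', hg, Nat.cast_one]
        rw [← abs_mul_abs_self (φ (e.1 0) 0)]
        ring
      simp only [h2] at h1
      have h3 : Integrable (fun e : Episode S A 1 => φ (e.1 0) 0 * φ (e.1 0) 0)
          (episodeLaw M 1 π ν₀) :=
        integrable_of_abs_le (measurable_trajFeature_mul hφm ((0 : Fin 1), (0 : Fin 1)) (0, 0))
          fun e => abs_trajFeature_mul_le hφ1 e.1 (0, 0) (0, 0)
      have h3g : Integrable g (episodeLaw M 1 π ν₀) := integrable_of_abs_le (B := 1) hgm fun e => by
        rw [abs_of_nonneg (hg0 e)]; exact hg1 e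
      rw [integral_sub h3g (h3.mul_const _), integral_mul_const, sub_eq_zero] at h1
      rw [h1]
      refine mul_le_mul_of_nonneg_right ?_ (abs_nonneg _)
      have h4 := hc.le_dotProduct 1
      simp [dotProduct, Matrix.mulVec, Fintype.sum_prod_type, trajMoment, trajFeature] at h4
      exact h4
    have hGm : Measurable fun ω => g (D 0 ω) := hgm.comp (hD 0)
    refine ⟨{ω | (D 0 ω).2 ∈ Set.Icc (0 : ℝ) 1} ∩ {ω | 2 * (β₁ + β₂) < g (D 0 ω)},
      ((measurable_snd.comp (hD 0)) measurableSet_Icc).inter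
        (measurableSet_lt measurable_const hGm), ?_, ?_⟩
    · have h1 := integral_sub_le_measureReal_lt (Pr := Pr) hGm (fun ω => hg0 _) (fun ω => hg1 _)
        (t := 2 * (β₁ + β₂)) (by positivity)
      have h2 : ∫ ω, g (D 0 ω) ∂Pr = ∫ e, g e ∂(episodeLaw M 1 π ν₀) := by
        rw [← hlaw 0, integral_map (hD 0).aemeasurable hgm.aestronglyMeasurable]
      have h3 : ∀ᵐ ω ∂Pr, ω ∈ {ω | (D 0 ω).2 ∈ Set.Icc (0 : ℝ) 1} := by
        have h4 := ae_return_mem M 1 π ν₀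
        rw [← hlaw 0] at h4
        simpa using ae_of_ae_map (hD 0).aemeasurable h4
      rw [measureReal_def, Measure.measure_inter_eq_of_ae h3, ← measureReal_def]
      have h5 : c * η ≤ c * |ϑ| := mul_le_mul_of_nonneg_left hϑη.le hc0
      linarith
    · rintro ω ⟨hω2, hω1⟩ πhat hout s
      refine (subOpt_nonpos_of_lt hM (D := fun i => D i ω) hω2 hβ₁ hβ₂ ?_ hout hϑ0 hR s).trans hη
      have h1 : 2 * (β₁ + β₂) < |φ ((D 0 ω).1 0) 0| * clip 1 (D 0 ω).2 := hω1
      rwa [clip_of_mem hω2, mul_comm |_|] at h1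

end SingleObservation

/-! ### The sub-optimality bound -/

/-- Bounds on the argument of the logarithm that avoid the fractional power of `N`. -/
lemma log_argument_ge {d H N : ℕ} (hd : 0 < d) (hH : 0 < H) (hN : 0 < N) :
    (d : ℝ) * H * N ^ 2 ≤ d * (H : ℝ) ^ 3 * (N : ℝ) ^ (5 / 2 : ℝ) ∧
      (N : ℝ) ≤ d * (H : ℝ) ^ 3 * (N : ℝ) ^ (5 / 2 : ℝ) := by
  have hd1 : (1 : ℝ) ≤ d := by exact_mod_cast hd
  have hH1 : (1 : ℝ) ≤ H := by exact_mod_cast hH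
  have hN1 : (1 : ℝ) ≤ N := by exact_mod_cast hN
  have h1 : (N : ℝ) ^ 2 ≤ (N : ℝ) ^ (5 / 2 : ℝ) := by
    rw [← Real.rpow_natCast]
    exact Real.rpow_le_rpow_of_exponent_le hN1 (by norm_num)
  have h2 : (H : ℝ) ≤ (H : ℝ) ^ 3 := le_self_pow₀ hH1 (by norm_num)
  have h3 : (d : ℝ) * H * N ^ 2 ≤ d * (H : ℝ) ^ 3 * (N : ℝ) ^ (5 / 2 : ℝ) := by gcongr
  refine ⟨h3, le_trans ?_ h3⟩
  have h4 : (N : ℝ) ≤ (N : ℝ) ^ 2 := le_self_pow₀ hN1 (by norm_num)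
  have h5 : (1 : ℝ) ≤ d * H := one_le_mul_of_one_le_of_one_le hd1 hH1
  nlinarith

/-- The failure probability of the regular data, for the thresholds used below. -/
lemma failure_probability_le {d H N : ℕ} (hd : 0 < d) (hH : 0 < H) (hN2 : 2 ≤ N) {δ G : ℝ}
    (hδ0 : 0 < δ) (hδ1 : δ < 1) (hG1 : (d : ℝ) * H * N ^ 2 ≤ G) :
    (H * d : ℝ) ^ 2 * (2 * (δ / G) ^ 8) + H * d * (2 * (δ / G) ^ 8) +
      H * d * (2 * (2 * H * N : ℕ) + 1) ^ d * (2 * (δ / G) ^ (8 * d)) ≤ δ := by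
  have hd1 : (1 : ℝ) ≤ d := by exact_mod_cast hd
  have hH1 : (1 : ℝ) ≤ H := by exact_mod_cast hH
  have hN2' : (2 : ℝ) ≤ N := by exact_mod_cast hN2
  have hdH0 : (1 : ℝ) ≤ d * H := one_le_mul_of_one_le_of_one_le hd1 hH1
  have hN4 : (4 : ℝ) ≤ N ^ 2 := by nlinarith
  have h4 : (d : ℝ) * H * 4 ≤ G := le_trans (by gcongr) hG1
  have hG4 : 4 ≤ G := by linarith
  have hGpos : 0 < G := by linarith
  have hkG : (H : ℝ) * d ≤ G := by linarith
  have hgG : (2 * (2 * H * N : ℕ) + 1 : ℝ) ≤ G ^ 2 := by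
    push_cast
    have h2 : (H : ℝ) * N ^ 2 ≤ G := by
      refine le_trans ?_ hG1
      have : (0 : ℝ) ≤ H * N ^ 2 := by positivity
      rw [mul_assoc]
      exact le_mul_of_one_le_left this hd1
    have h3 : ((H : ℝ) * N ^ 2) ^ 2 ≤ G ^ 2 := by gcongr
    have h4 : (2 : ℝ) ^ 3 ≤ N ^ 3 := by gcongr
    have h5 : (1 : ℝ) ≤ H * N := one_le_mul_of_one_le_of_one_le hH1 (by linarith)
    have h6 : (H : ℝ) * N * 2 ^ 3 ≤ H * N * N ^ 3 := by gcongr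
    have h7 : (H : ℝ) * N * N ^ 3 ≤ (H * N ^ 2) ^ 2 := by
      have : (H : ℝ) ≤ H ^ 2 := le_self_pow₀ hH1 two_ne_zero
      calc (H : ℝ) * N * N ^ 3 = (H : ℝ) * (N : ℝ) ^ 4 := by ring
        _ ≤ (H : ℝ) ^ 2 * (N : ℝ) ^ 4 := by gcongr
        _ = ((H : ℝ) * (N : ℝ) ^ 2) ^ 2 := by ring
    linarith
  refine union_bound_le hd (by positivity) (div_le_self hδ0.le (by linarith)) ?_ (by positivity) ?_
    (by positivity) ?_
  · rw [div_le_iff₀ hGpos]; linarith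
  · rw [← mul_div_assoc, div_le_one hGpos]
    exact (mul_le_of_le_one_right (by positivity) hδ1.le).trans hkG
  · rw [div_pow, ← mul_div_assoc, div_le_one (by positivity)]
    exact (mul_le_of_le_one_right (by positivity) (pow_le_one₀ hδ0.le hδ1.le)).trans hgG

/-- The case of at least two observations and a bound per step below `c / 16`. -/
lemma exists_event_of_two_le {S A Ω : Type*} [MeasurableSpace S] [MeasurableSpace A] [Fintype A]
    [MeasurableSingletonClass A] [MeasurableSpace Ω] {Pr : Measure Ω} [IsProbabilityMeasure Pr]
    {d H N : ℕ} (hd : 0 < d) (hH : 0 < H) (hN2 : 2 ≤ N) {δ : ℝ} (hδ0 : 0 < δ) (hδ1 : δ < 1)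
    {M : MDP S A} {Z : Set S} {φ : S × A → EuclideanSpace ℝ (Fin d)} (hM : IsLinearMDP M H Z φ)
    (π : Policy S A) (ν₀ : Measure S) [IsProbabilityMeasure ν₀] {c : ℝ} (hc : 0 < c)
    (hexp : MinEigenvalueGE (trajMoment φ (episodeLaw M H π ν₀)) c)
    {D : Fin N → Ω → Episode S A H} (hD : ∀ i, Measurable (D i)) (hind : iIndepFun D Pr)
    (hlaw : ∀ i, Measure.map (D i) Pr = episodeLaw M H π ν₀) {G q l X : ℝ}
    (hG1 : (d : ℝ) * H * N ^ 2 ≤ G) (hq : q = √(N : ℝ)) (hl : l = √(Real.log (G / δ)))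
    (hXq : X * q = d * (H : ℝ) ^ 2 * l) (hXc : 16 * X ≤ c) {β₁ β₂ P : ℝ}
    (hβ₁ : 0 ≤ β₁) (hβ₂ : 0 ≤ β₂) (hP : (β₁ + β₂) * √(2 / c) ≤ P * (X * q)) :
    ∃ E : Set Ω, MeasurableSet E ∧ 1 - δ ≤ Pr.real E ∧ ∀ ω ∈ E, ∀ πhat : Policy S A,
      IsOutput φ 1 1 β₁ β₂ (fun i => D i ω) πhat →
        ∀ s, subOpt M H πhat s ≤ 2 * ((32 + 4 * P) / c + P) * X * H := by
  have hd1 : (1 : ℝ) ≤ d := by exact_mod_cast hd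
  have hH1 : (1 : ℝ) ≤ H := by exact_mod_cast hH
  have hN2' : (2 : ℝ) ≤ N := by exact_mod_cast hN2
  have hG4 : 4 ≤ G := by
    have h1 : (1 : ℝ) ≤ d * H := one_le_mul_of_one_le_of_one_le hd1 hH1
    have h2 : (4 : ℝ) ≤ N ^ 2 := by nlinarith
    have h3 : (1 : ℝ) * 4 ≤ d * H * N ^ 2 := by gcongr
    linarith
  have hGpos : 0 < G := by linarith
  have hq1 : 1 ≤ q := hq ▸ Real.one_le_sqrt.2 (by linarith)
  have hq0 : 0 < q := by linarith
  have hqq : q ^ 2 = N := hq ▸ Real.sq_sqrt (by linarith)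
  set L := Real.log (G / δ) with hL
  have hL1 : 1 ≤ L := by
    rw [hL, Real.le_log_iff_exp_le (by positivity), le_div_iff₀ hδ0]
    have h1 := Real.exp_one_lt_d9
    have h2 : Real.exp 1 * δ ≤ Real.exp 1 := mul_le_of_le_one_right (Real.exp_pos 1).le hδ1.le
    linarith
  have hll : l ^ 2 = L := hl ▸ Real.sq_sqrt (by linarith)
  have hl1 : 1 ≤ l := hl ▸ Real.one_le_sqrt.2 hL1
  set x := Real.exp (-L) with hx
  have hxG : x = δ / G := by
    rw [hx, Real.exp_neg, hL, Real.exp_log (by positivity), inv_div]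
  -- the thresholds make the Hoeffding exponents `-8 L`, and `-8 d L` for the grid; the mesh `1 / √N`
  -- with `2 H N` points on either side covers the range `2 H √N` of the estimated scores
  obtain ⟨E, hE, hPE, hreg⟩ := exists_isRegularData (Pr := Pr) M hM.2.1 hM.2.2.1 π ν₀ hD hind
    hlaw (1 / q) (2 * H * N) (t₁ := 8 * q * l) (t₂ := 4 * H * q * l)
    (t₃ := 8 * H * q * l * √(d : ℝ)) (by positivity) (by positivity) (by positivity)
  refine ⟨E, hE, ?_, fun ω hω πhat hout s => ?_⟩
  · have e1 : Real.exp (-(8 * q * l) ^ 2 / (2 * N * 2 ^ 2)) = x ^ 8 := by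
      rw [hx, ← Real.exp_nat_mul]
      congr 1
      rw [← hqq, ← hll]
      push_cast
      field_simp
      norm_num
    have e2 : Real.exp (-(4 * H * q * l) ^ 2 / (2 * N * (H : ℝ) ^ 2)) = x ^ 8 := by
      rw [hx, ← Real.exp_nat_mul]
      congr 1
      rw [← hqq, ← hll]
      push_cast
      field_simp
      norm_num
    have e3 : Real.exp (-(8 * H * q * l * √(d : ℝ)) ^ 2 / (2 * N * (2 * H : ℝ) ^ 2)) =
        x ^ (8 * d) := by
      rw [hx, ← Real.exp_nat_mul]
      congr 1
      rw [mul_pow _ √(d : ℝ), Real.sq_sqrt (by linarith), ← hqq, ← hll]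
      push_cast
      field_simp
      norm_num
    rw [e1, e2, e3, hxG] at hPE
    have hu := failure_probability_le hd hH hN2 hδ0 hδ1 hG1
    have h1 := probReal_compl_eq_one_sub (μ := Pr) hE
    linarith
  · have hX0 : 0 ≤ X :=
      nonneg_of_mul_nonneg_left (by rw [hXq]; positivity) hq0
    have hb := (hreg ω hω).subOpt_le hM hexp (m := c * q ^ 2 / 2) (by positivity) (by
        have h1 : (H : ℝ) * d * l ≤ X * q := by
          rw [hXq]
          have h2 : (H : ℝ) ≤ H ^ 2 := le_self_pow₀ hH1 two_ne_zero
          calc (H : ℝ) * d * l = d * H * l := by ring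
            _ ≤ d * (H : ℝ) ^ 2 * l := by gcongr
        have h2 : 8 * q * l * (H * d) ≤ 8 * X * q ^ 2 := by nlinarith
        have h3 : 16 * X * q ^ 2 ≤ c * q ^ 2 := by gcongr
        rw [← hqq]
        linarith) (by positivity) (by positivity) (by positivity) (by
        rw [← hq]
        push_cast
        rw [← hqq]
        refine le_of_eq ?_
        field_simp) hβ₁ hβ₂ hout s
    have herr := total_error_le hd1 hH1 hq1 hl1 hc hXq (β := β₁ + β₂) (P := P) hP
    rw [← hqq] at hb
    have h1 := hb.trans (mul_le_mul_of_nonneg_left herr (by positivity))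
    exact h1.trans_eq (by ring)

/-- Otherwise the logarithm is at least `log 2`, and the bound for a single observation is trivial. -/
lemma eq_one_of_mul_lt_one {d H : ℕ} (hd : 0 < d) (hH : 0 < H) {δ : ℝ} (hδ0 : 0 < δ) (hδ1 : δ < 1)
    (h : 2 * (d * (H : ℝ) ^ 2 * √(Real.log (d * (H : ℝ) ^ 3 / δ))) < 1) : d = 1 ∧ H = 1 := by
  have hd1 : (1 : ℝ) ≤ d := by exact_mod_cast hd
  have hH1 : (1 : ℝ) ≤ H := by exact_mod_cast hH
  have hdH : d * H ^ 3 < 2 := by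
    by_contra hcon
    have h1 : (2 : ℝ) ≤ d * (H : ℝ) ^ 3 := by exact_mod_cast not_lt.1 hcon
    have h2 : Real.log 2 ≤ Real.log (d * (H : ℝ) ^ 3 / δ) := by
      refine Real.log_le_log two_pos (h1.trans ?_)
      exact le_div_self (by positivity) hδ0 hδ1.le
    have h3 : 1 / 2 ≤ √(Real.log (d * (H : ℝ) ^ 3 / δ)) :=
      Real.le_sqrt_of_sq_le (by linarith [Real.log_two_gt_d9])
    have h4 : (1 : ℝ) ≤ d * (H : ℝ) ^ 2 :=
      one_le_mul_of_one_le_of_one_le hd1 (one_le_pow₀ hH1)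
    have h5 := mul_le_mul h4 h3 (by norm_num) (by positivity)
    linarith
  have hH' : H = 1 := by
    by_contra hcon
    have h1 : 2 ^ 3 ≤ H ^ 3 := Nat.pow_le_pow_left (by omega) 3
    have h2 : 1 * H ^ 3 ≤ d * H ^ 3 := Nat.mul_le_mul_right _ hd
    omega
  subst hH'
  exact ⟨by omega, rfl⟩

end PARTED

section

open PARTED

theorem theorem2 (Cβ₁ Cβ₂ Cσ Cς : ℝ) (hCβ₁ : 0 < Cβ₁) (hCβ₂ : 0 < Cβ₂)
    (hCσ : 0 < Cσ) (hCς : 0 < Cς) :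
    ∃ C : ℝ, 0 < C ∧
      ∀ (S : Type*) (A : Type*) (Ω : Type*) [MeasurableSpace S] [MeasurableSpace A]
        [Fintype A] [MeasurableSingletonClass A] [MeasurableSpace Ω]
        (Pr : Measure Ω) [IsProbabilityMeasure Pr]
        (d H N : ℕ), 0 < d → 0 < H → 0 < N →
      ∀ (δ : ℝ), 0 < δ → δ < 1 →
      ∀ (M : PARTED.MDP S A) (Z : Set S) (φ : S × A → EuclideanSpace ℝ (Fin d)),
        PARTED.IsLinearMDP M H Z φ →
      ∀ (μ : PARTED.Policy S A) (ν₀ : Measure S) [IsProbabilityMeasure ν₀],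
        PARTED.WellExplored φ (PARTED.episodeLaw M H μ ν₀) Cσ Cς →
      ∀ (D : Fin N → Ω → PARTED.Episode S A H),
        (∀ i, Measurable (D i)) → iIndepFun D Pr →
        (∀ i, Measure.map (D i) Pr = PARTED.episodeLaw M H μ ν₀) →
      ∀ (β₁ β₂ : ℝ),
        0 < β₁ → β₁ ≤ Cβ₁ * (H * √(d * H * Real.log (N / δ))) →
        0 < β₂ →
        β₂ ≤ Cβ₂ * (d * (H : ℝ) ^ 2 *
          √(Real.log (d * (H : ℝ) ^ 3 * (N : ℝ) ^ (5 / 2 : ℝ) / δ))) →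
      ∃ E : Set Ω, MeasurableSet E ∧ ENNReal.ofReal (1 - δ) ≤ Pr E ∧
        ∀ ω ∈ E, ∀ πhat : PARTED.Policy S A,
          PARTED.IsOutput φ 1 1 β₁ β₂ (fun i => D i ω) πhat →
          ∀ s : S, PARTED.subOpt M H πhat s ≤
            C * (d * (H : ℝ) ^ 3 / √(N : ℝ) *
              √(Real.log (d * (H : ℝ) ^ 3 * (N : ℝ) ^ (5 / 2 : ℝ) / δ))) := by
  set P := (Cβ₁ + Cβ₂) * √(2 / Cσ) with hP
  have hP0 : 0 ≤ P := by positivity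
  -- the summands serve the main case, the case of a single observation with `d H > 1`, and the
  -- case `N = d = H = 1`
  refine ⟨2 * ((32 + 4 * P) / Cσ + P) + 2 + (1 + 2 * (Cβ₁ + Cβ₂)) / Cσ, by positivity, ?_⟩
  set C := 2 * ((32 + 4 * P) / Cσ + P) + 2 + (1 + 2 * (Cβ₁ + Cβ₂)) / Cσ with hC
  have hC2 : 2 ≤ C := by
    have : 0 ≤ 2 * ((32 + 4 * P) / Cσ + P) + (1 + 2 * (Cβ₁ + Cβ₂)) / Cσ := by positivity
    linarith
  have hCe : 2 * ((32 + 4 * P) / Cσ + P) ≤ C := by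
    have : 0 ≤ (1 + 2 * (Cβ₁ + Cβ₂)) / Cσ := by positivity
    linarith
  have hCs : 1 + 2 * (Cβ₁ + Cβ₂) ≤ Cσ * C := by
    have h1 : (1 + 2 * (Cβ₁ + Cβ₂)) / Cσ ≤ C := by
      have : 0 ≤ 2 * ((32 + 4 * P) / Cσ + P) := by positivity
      linarith
    rwa [div_le_iff₀' hCσ] at h1
  have hC16 : 16 ≤ Cσ * C := by
    have h1 : 64 / Cσ ≤ C := by
      refine le_trans ?_ hCe
      rw [mul_add, ← mul_div_assoc]
      have : 64 / Cσ ≤ 2 * (32 + 4 * P) / Cσ := by gcongr; linarith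
      linarith
    rw [div_le_iff₀' hCσ] at h1
    linarith
  intro S A Ω _ _ _ _ _ Pr _ d H N hd hH hN δ hδ0 hδ1 M Z φ hM π ν₀ _ hexp D hD hind hlaw
    β₁ β₂ hβ₁ hβ₁le hβ₂ hβ₂le
  obtain ⟨hG1, hG2⟩ := log_argument_ge hd hH hN
  set G : ℝ := d * (H : ℝ) ^ 3 * (N : ℝ) ^ (5 / 2 : ℝ) with hG
  set L := Real.log (G / δ) with hL
  have hd1 : (1 : ℝ) ≤ d := by exact_mod_cast hd
  have hH1 : (1 : ℝ) ≤ H := by exact_mod_cast hH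
  have hN1 : (1 : ℝ) ≤ N := by exact_mod_cast hN
  have hGpos : 0 < G := by linarith
  set q := √(N : ℝ) with hq
  set l := √L with hl
  have hq1 : 1 ≤ q := Real.one_le_sqrt.2 hN1
  have hq0 : 0 < q := by linarith
  have hqq : q ^ 2 = N := Real.sq_sqrt (by linarith)
  have hl0 : 0 ≤ l := Real.sqrt_nonneg _
  have hL0 : 0 ≤ L := Real.log_nonneg (by rw [le_div_iff₀ hδ0]; linarith)
  have hll : l ^ 2 = L := Real.sq_sqrt hL0
  -- the bound per step, up to constants
  set X := d * (H : ℝ) ^ 2 * l / q with hX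
  have hX0 : 0 ≤ X := by positivity
  have hXq : X * q = d * (H : ℝ) ^ 2 * l := by rw [hX]; field_simp
  have hgoal : C * (d * (H : ℝ) ^ 3 / q * l) = C * X * H := by rw [hX]; ring
  rw [hgoal]
  by_cases hbig : 1 ≤ C * X
  · refine ⟨Set.univ, MeasurableSet.univ, ?_, fun ω _ πhat _ s => ?_⟩
    · rw [measure_univ, ENNReal.ofReal_le_one]; linarith
    · exact (subOpt_le_horizon M H πhat s).trans (le_mul_of_one_le_left (by linarith) hbig)
  rw [not_le] at hbig
  suffices h : ∃ E : Set Ω, MeasurableSet E ∧ 1 - δ ≤ Pr.real E ∧ ∀ ω ∈ E, ∀ πhat : Policy S A,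
      IsOutput φ 1 1 β₁ β₂ (fun i => D i ω) πhat → ∀ s, subOpt M H πhat s ≤ C * X * H by
    obtain ⟨E, hE, hPE, hsub⟩ := h
    exact ⟨E, hE, ENNReal.ofReal_le_of_le_toReal hPE, hsub⟩
  -- the two penalties are of the order of the bound per step
  have hβ₁' : β₁ ≤ Cβ₁ * (X * q) := by
    refine hβ₁le.trans (mul_le_mul_of_nonneg_left ?_ hCβ₁.le)
    have h1 : Real.log (N / δ) ≤ L := Real.log_le_log (by positivity) (by gcongr)
    have h2 : √(d * H * Real.log (N / δ)) ≤ d * H * l := by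
      refine Real.sqrt_le_iff.2 ⟨by positivity, ?_⟩
      rw [mul_pow, hll]
      have h3 : (1 : ℝ) ≤ d * H := one_le_mul_of_one_le_of_one_le hd1 hH1
      have h4 : (d : ℝ) * H ≤ (d * H) ^ 2 := le_self_pow₀ h3 two_ne_zero
      exact (mul_le_mul_of_nonneg_left h1 (by positivity)).trans
        (mul_le_mul_of_nonneg_right h4 hL0)
    rw [hXq]
    calc (H : ℝ) * √(d * H * Real.log (N / δ)) ≤ H * (d * H * l) := by gcongr
      _ = d * (H : ℝ) ^ 2 * l := by ring
  have hβ₂' : β₂ ≤ Cβ₂ * (X * q) := by rw [hXq]; exact hβ₂le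
  rcases Nat.lt_or_ge N 2 with hN2 | hN2
  · -- with one observation, a bound below the trivial one is possible only for `d = H = 1`
    obtain rfl : N = 1 := by omega
    have hq' : q = 1 := by rw [hq]; simp
    rw [hq', mul_one] at hXq hβ₁' hβ₂'
    have hG' : G = d * (H : ℝ) ^ 3 := by rw [hG]; simp
    have hX2 : 2 * (d * (H : ℝ) ^ 2 * √(Real.log (d * (H : ℝ) ^ 3 / δ))) < 1 := by
      rw [← hG', ← hL, ← hl, ← hXq]
      exact (mul_le_mul_of_nonneg_right hC2 hX0).trans_lt hbig
    obtain ⟨rfl, rfl⟩ := eq_one_of_mul_lt_one hd hH hδ0 hδ1 hX2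
    have hXl : X = l := by rw [hXq]; simp
    have hLδ : 1 - δ ≤ L := by
      have h1 : L = -Real.log δ := by rw [hL, hG']; simp
      rw [h1]
      linarith [Real.log_le_sub_one_of_pos hδ0]
    have hl1 : l ≤ 1 := by
      have := mul_le_mul_of_nonneg_right hC2 hl0
      rw [hXl] at hbig
      linarith
    have h1δ : 1 - δ ≤ l := hLδ.trans (by rw [← hll]; exact pow_le_of_le_one hl0 hl1 two_ne_zero)
    rw [hXl] at hβ₁' hβ₂'
    have hmain := exists_event_single (Pr := Pr) hM π ν₀ hexp.1 hD hlaw hβ₁.le hβ₂.le hCσ.le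
      (η := C * X * (1 : ℕ)) (p := 1 - δ) (by rw [hXl]; positivity) (by linarith) (by
        have h1 := mul_le_mul_of_nonneg_right hCs hl0
        rw [hXl, Nat.cast_one, mul_one]
        linarith)
    exact hmain
  · have hXc : 16 * X ≤ Cσ := by
      have h1 : 16 * X ≤ Cσ * C * X := mul_le_mul_of_nonneg_right hC16 hX0
      have h2 : Cσ * (C * X) ≤ Cσ * 1 := mul_le_mul_of_nonneg_left hbig.le hCσ.le
      linarith
    obtain ⟨E, hE, hPE, hsub⟩ := exists_event_of_two_le (Pr := Pr) hd hH hN2 hδ0 hδ1 hM π ν₀ hCσ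
      hexp.1 hD hind hlaw hG1 hq hl hXq hXc hβ₁.le hβ₂.le (P := P) (by
        have h1 : β₁ + β₂ ≤ (Cβ₁ + Cβ₂) * (X * q) := by linarith
        rw [hP]
        calc (β₁ + β₂) * √(2 / Cσ) ≤ (Cβ₁ + Cβ₂) * (X * q) * √(2 / Cσ) := by gcongr
          _ = (Cβ₁ + Cβ₂) * √(2 / Cσ) * (X * q) := by ring)
    refine ⟨E, hE, hPE, fun ω hω πhat hout s => (hsub ω hω πhat hout s).trans ?_⟩
    gcongr

end
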